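/- Let $\mathbb{E}^{2,1}=\mathbb{R}^3$ be Minkowski space with the Lorentz inner product $\langle u,v\rangle=u_1v_1+u_2v_2-u_3v_3$. Let $\mathrm{Ein}^{2,1}$ be the projectivization of the nullcone $\mathfrak N=\{(X,Y,Z,U,V)\in\mathbb{R}^5\setminus\{0\} : X^2+Y^2-Z^2-UV=0\}$, let $\widehat{\mathrm{Ein}}^{2,1}$ be the quotient of $\mathfrak N$ by positive scalar multiplications, and let $\pi:\widehat{\mathrm{Ein}}^{2,1}\to\mathrm{Ein}^{2,1}$ be the natural double covering. Regard $\mathbb{E}^{2,1}$ as a subset of $\mathrm{Ein}^{2,1}$ through the embedding $x\mapsto[x:\langle x,x\rangle:1]$. For $p\in\mathbb{E}^{2,1}$ and a nonzero null vector $v$, the wings $\mathcal W^{\pm}$ of the lightlike geodesic $\ell=p+\mathbb{R}v$ are $$\mathcal W^{\pm}(\ell)=\{p+w : \langle w,v\rangle=0,\ \pm\det(u,v,w)>0\},$$ where $u$ is any timelike vector with $\langle u,v\rangle<0$ (the choices of $u$ and $v$ do not matter). A crooked plane is a set $$C=\mathcal W^{+}(\ell_1)\cup\mathcal S(\ell_1,\ell_2)\cup\mathcal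 W^{+}(\ell_2)\quad\text{or}\quad C=\mathcal W^{-}(\ell_1)\cup\mathcal S(\ell_1,\ell_2)\cup\mathcal W^{-}(\ell_2),$$ where $\ell_i=p+\mathbb{R}v_i$ ($i=1,2$) are two distinct lightlike geodesics through a point $p$, and the stem is $\mathcal S(\ell_1,\ell_2)=\{p+w : w\in\operatorname{span}(v_1,v_2),\ \langle w,w\rangle\le 0\}$. Theorem. Let $C\subset\mathbb{E}^{2,1}$ be a crooked plane and let $\overline C$ be its closure in $\mathrm{Ein}^{2,1}$. Then $\overline C$, with the subspace topology, is a topological surface homeomorphic to the Klein bottle. Moreover its lift $\pi^{-1}(\overline C)\subset\widehat{\mathrm{Ein}}^{2,1}$, together with the restriction of $\pi$ to a map $\pi^{-1}(\overline C)\to\overline C$, is the orientation double covering of $\overline C$ (that is, it is a two-sheeted covering, isomorphic over $\overline C$ to the covering whose fiber at $x$ is the set of the two local orientations of $\overline C$ at $x$), and $\pi^{-1}(\overline C)$ is homeomorphic to the torus $S^1\times S^1$. -/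

import Mathlib

open Set Topology
open scoped unitInterval

namespace Crooked

/-! ### Minkowski space `𝔼²·¹` and crooked planes -/

/-- Minkowski space `𝔼²·¹`, identified with its vector space of translations `ℝ²·¹`. -/
abbrev Mink : Type := Fin 3 → ℝ

/-- The Lorentz inner product `I₂ ⊕ -I₁` on `ℝ²·¹`. -/
def lorentz (u v : Mink) : ℝ := u 0 * v 0 + u 1 * v 1 - u 2 * v 2

/-- The causal future of `p`: the points `q` with `q - p` zero or causal and future-oriented. -/
def causalFuture (p : Mink) : Set Mink :=
  {q | lorentz (q - p) (q - p) ≤ 0 ∧ 0 ≤ (q - p) 2}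

/-- The causal past of `p`: the points `q` with `q - p` zero or causal and past-oriented. -/
def causalPast (p : Mink) : Set Mink :=
  {q | lorentz (q - p) (q - p) ≤ 0 ∧ (q - p) 2 ≤ 0}

/-- The null plane `ℓ^⊥ = p + v^⊥` containing the lightlike geodesic `ℓ = p + ℝ v`. -/
def nullPlane (p v : Mink) : Set Mink := {q | lorentz (q - p) v = 0}

/-- The positive wing `𝒲⁺(ℓ)` of the lightlike geodesic `ℓ = p + ℝ v`: the points `p + w` of the
null plane of `ℓ` with `det (u, v, w) > 0`, where `u` is a timelike vector with `⟨u, v⟩ < 0`. The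
sign of the determinant does not depend on `u`. -/
def posWing (p v : Mink) : Set Mink :=
  {q | q ∈ nullPlane p v ∧
    ∃ u : Mink, lorentz u u < 0 ∧ lorentz u v < 0 ∧ 0 < Matrix.det (Matrix.of ![u, v, q - p])}

/-- The negative wing `𝒲⁻(ℓ)` of the lightlike geodesic `ℓ = p + ℝ v`. -/
def negWing (p v : Mink) : Set Mink :=
  {q | q ∈ nullPlane p v ∧
    ∃ u : Mink, lorentz u u < 0 ∧ lorentz u v < 0 ∧ Matrix.det (Matrix.of ![u, v, q - p]) < 0}

/-- The stem of the lightlike geodesics `p + ℝ v₁` and `p + ℝ v₂`: the part of the plane that they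
span which is causally related to `p`. -/
def stem (p v₁ v₂ : Mink) : Set Mink :=
  (causalFuture p ∪ causalPast p) ∩ {q | q - p ∈ Submodule.span ℝ {v₁, v₂}}

/-- `C` is a (positively or negatively oriented) crooked plane: for some vertex `p` and some pair
of distinct lightlike geodesics `p + ℝ v₁` and `p + ℝ v₂`, it is the union of the stem and of the
two positive wings, or of the stem and of the two negative wings. -/
def IsCrookedPlane (C : Set Mink) : Prop :=
  ∃ p v₁ v₂ : Mink, lorentz v₁ v₁ = 0 ∧ lorentz v₂ v₂ = 0 ∧ LinearIndependent ℝ ![v₁, v₂] ∧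
    (C = posWing p v₁ ∪ stem p v₁ v₂ ∪ posWing p v₂ ∨
      C = negWing p v₁ ∪ stem p v₁ v₂ ∪ negWing p v₂)

/-! ### The Einstein universe and its double covering -/

/-- The quadratic form `X² + Y² - Z² - U V`, of type `(3, 2)`, on `ℝ³·²`. -/
def form32 (v : Fin 5 → ℝ) : ℝ := v 0 ^ 2 + v 1 ^ 2 - v 2 ^ 2 - v 3 * v 4

/-- The nullcone of `ℝ³·²` without the origin. -/
abbrev NullVec : Type := {v : Fin 5 → ℝ // v ≠ 0 ∧ form32 v = 0}

/-- Proportionality by a nonzero real number. -/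
def projSetoid : Setoid NullVec where
  r v w := ∃ c : ℝ, c ≠ 0 ∧ w.1 = c • v.1
  iseqv :=
    { refl := fun v => ⟨1, one_ne_zero, (one_smul ℝ v.1).symm⟩
      symm := by
        rintro v w ⟨c, hc, h⟩
        exact ⟨c⁻¹, inv_ne_zero hc, by rw [h, inv_smul_smul₀ hc]⟩
      trans := by
        rintro u v w ⟨c, hc, h⟩ ⟨d, hd, h'⟩
        exact ⟨d * c, mul_ne_zero hd hc, by rw [h', h, smul_smul]⟩ }

/-- Proportionality by a positive real number. -/
def raySetoid : Setoid NullVec where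
  r v w := ∃ c : ℝ, 0 < c ∧ w.1 = c • v.1
  iseqv :=
    { refl := fun v => ⟨1, one_pos, (one_smul ℝ v.1).symm⟩
      symm := by
        rintro v w ⟨c, hc, h⟩
        exact ⟨c⁻¹, inv_pos.2 hc, by rw [h, inv_smul_smul₀ hc.ne']⟩
      trans := by
        rintro u v w ⟨c, hc, h⟩ ⟨d, hd, h'⟩
        exact ⟨d * c, mul_pos hd hc, by rw [h', h, smul_smul]⟩ }

/-- The Einstein universe `Ein²·¹`, the projectivized nullcone of `ℝ³·²`, with the quotient
topology. -/
abbrev Ein : Type := Quotient projSetoid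

/-- The double covering of `Ein²·¹`: the quotient of the nullcone without the origin by the
positive scalar multiplications, with the quotient topology. -/
abbrev DoubleEin : Type := Quotient raySetoid

/-- The covering projection of the double covering onto `Ein²·¹`. -/
def einProj : DoubleEin → Ein :=
  Quotient.map' (s₁ := raySetoid) (s₂ := projSetoid) id
    (fun _ _ ⟨c, hc, h⟩ => ⟨c, hc.ne', h⟩)

/-- The null vector `(x, ⟨x, x⟩, 1)` of `ℝ³·²` attached to a point `x` of Minkowski space. -/
def paraboloid (x : Mink) : NullVec :=
  ⟨![x 0, x 1, x 2, lorentz x x, 1],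
    fun h => one_ne_zero (α := ℝ) (congrFun h 4),
    by simp [form32, lorentz]; ring⟩

/-- The conformal embedding of Minkowski space in the Einstein universe. -/
def embed (x : Mink) : Ein := Quotient.mk projSetoid (paraboloid x)

/-- The crooked surface of a crooked plane `C`: its closure in the Einstein universe. -/
def crookedSurface (C : Set Mink) : Set Ein := closure (embed '' C)

/-- The lift of a subset of `Ein²·¹` to the double covering: its full preimage. -/
def lift (S : Set Ein) : Set DoubleEin := einProj ⁻¹' S

/-- The restriction of the covering projection to the lift of a set. -/
def liftProj (S : Set Ein) : lift S → S := fun x => ⟨einProj x.1, x.2⟩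

/-! ### Surfaces, the Klein bottle, and the orientation double covering -/

/-- A topological surface: a second countable Hausdorff space in which every point has an open
neighbourhood homeomorphic to an open subset of the plane. -/
def IsTopologicalSurface (M : Type*) [TopologicalSpace M] : Prop :=
  T2Space M ∧ SecondCountableTopology M ∧ ∀ x : M, ∃ φ : OpenPartialHomeomorph M ℂ, x ∈ φ.source

/-- The identifications of the sides of the unit square that produce the Klein bottle:
`(0, y) ∼ (1, 1 - y)` and `(x, 0) ∼ (x, 1)`. -/
inductive KleinRel : I × I → I × I → Prop
  | flip (y : I) : KleinRel (0, y) (1, σ y)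
  | glue (x : I) : KleinRel (x, 0) (x, 1)

/-- The Klein bottle: the quotient of the unit square by the equivalence relation generated by the
above identifications, with the quotient topology. -/
abbrev KleinBottle : Type := Quot KleinRel

/-- A map `f` between open subsets of the plane preserves the orientation at `z`: on every small
circle around `z`, run counterclockwise, the vector `f - f z` does not vanish and turns exactly
once counterclockwise. The function `L` is a continuous logarithm of this vector. -/
def PreservesOrientationAt (f : ℂ → ℂ) (z : ℂ) : Prop :=
  ∀ᶠ r : ℝ in 𝓝[>] 0, ∃ L : ℝ → ℂ, Continuous L ∧
    (∀ t : ℝ, f (z + r * Complex.exp (t * Complex.I)) - f z = Complex.exp (L t)) ∧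
    L (2 * Real.pi) = L 0 + 2 * Real.pi * Complex.I

variable (M : Type*) [TopologicalSpace M]

/-- The planar charts of `M` around `x`. -/
abbrev ChartAt (x : M) : Type _ := {φ : OpenPartialHomeomorph M ℂ // x ∈ φ.source}

/-- The local orientations of a surface `M` at `x`: the classes of charts around `x`, where two
charts are identified when the transition map between them preserves the orientation at `x`. -/
def LocalOrientation (x : M) : Type _ :=
  Quot fun φ ψ : ChartAt M x => PreservesOrientationAt (ψ.1 ∘ φ.1.symm) (φ.1 x)

/-- The total space of the orientation double covering of a surface `M`: the pairs of a point and
of a local orientation at this point. -/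
def OrientationSpace : Type _ := Σ x : M, LocalOrientation M x

variable {M}

/-- The local orientations at the points of `V` that a single chart induces. -/
def chartSheet (φ : OpenPartialHomeomorph M ℂ) (V : Set M) : Set (OrientationSpace M) :=
  {o | ∃ (y : M) (hy : y ∈ φ.source), y ∈ V ∧ o = ⟨y, Quot.mk _ ⟨φ, hy⟩⟩}

/-- The topology of the orientation double covering, with basis the sets of local orientations
that a chart induces at the points of an open set. -/
instance : TopologicalSpace (OrientationSpace M) :=
  TopologicalSpace.generateFrom
    {U | ∃ (φ : OpenPartialHomeomorph M ℂ) (V : Set M), IsOpen V ∧ U = chartSheet φ V}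

/-- `q : E → M` is the orientation double covering of the surface `M`: it is a two-sheeted covering
map, and it is isomorphic over `M` to the covering by the local orientations of `M`. -/
def IsOrientationDoubleCover {E : Type*} [TopologicalSpace E] (q : E → M) : Prop :=
  IsCoveringMap q ∧ (∀ x : M, (q ⁻¹' {x}).ncard = 2) ∧
    ∃ h : E ≃ₜ OrientationSpace M, ∀ e : E, (h e).1 = q e

end Crooked

/-!
In a null frame at the vertex the crooked plane is the union of the stem `c = 0, a b ≥ 0` and of the
wings `b = 0, c > 0` and `a = 0, c < 0` (`IsCrookedPlane.exists_nullFrame`), and the nullcone of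
`ℝ³·²` is `c² = a b + U V`, Minkowski space being `V ≠ 0`. With `A = a + b`, `D = a - b`,
`P = U + V` and `Q = V - U`, this is `A² + P² = D² + 4 c² + Q²`: the double covering is a circle of
points `(A, P)` times a sphere of points `(D, 2 c, Q)`. Over each `(A, P)`, the stem and the two
wings close up to a Jordan curve, two arcs of which lie in `c = 0` and two of which are half circles
`D = ± A`; the former degenerate for `A = 0`, the latter for `P = 0`. Setting `k² = D² + 4 c²`, with `k` of the sign of `A D` or `P c`, turns this curve into
the circle `k² + Q² = 1`. This gives an explicit continuous injection of the torus in the double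
covering (`surfaceCoord`, `NullFrame.param`). Its image lies over the closure of the crooked plane:
it is compact, and the points at infinity in it form a nowhere dense set
(`NullFrame.crookedSurface_eq_range`). In the angles `(A, P) = exp (iπx)`, `(k, Q) = exp (2πiy)`, the
antipodal map is the glide reflection `(x, y) ↦ (x + 1, -y)` (`NullFrame.isGlideModel`).

It follows that the closure is the quotient of the plane by the group generated by this glide
reflection and by the translation of `y` by `1`, a Klein bottle, and that its lift is the quotient
by the subgroup of translations, a torus. Since the glide reflection reverses the orientation of the
plane and translations preserve it, a point of the torus is the same thing as a point of the Klein
bottle with a local orientation (`IsGlideModel.isOrientationDoubleCover`).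

This last step needs that a homeomorphism between open sets of the plane has at each point a degree
`±1`, locally constant and multiplicative. The degree is defined by lifting the homeomorphism to
logarithmic coordinates around the point and around its image (`HasLocalDegree`): lifts compose,
which gives the multiplicativity, and they depend continuously on the point, which gives the local
constancy (`exists_eventually_hasLocalDegree`).
-/

namespace Crooked

/-! ### Local degree of planar homeomorphisms -/

/-- Two continuous logarithms of the same function on a preconnected set differ by a constant
integer multiple of `2πi`. -/
theorem exists_int_of_exp_eqOn {X : Type*} [TopologicalSpace X] {s : Set X}
    (hs : IsPreconnected s) {f g : X → ℂ} (hf : ContinuousOn f s) (hg : ContinuousOn g s)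
    (h : ∀ x ∈ s, Complex.exp (f x) = Complex.exp (g x)) :
    ∃ n : ℤ, ∀ x ∈ s, f x = g x + n * (2 * Real.pi * Complex.I) := by
  rcases s.eq_empty_or_nonempty with rfl | ⟨a, ha⟩
  · exact ⟨0, by simp⟩
  obtain ⟨n, hn⟩ := Complex.exp_eq_exp_iff_exists_int.1 (h a ha)
  refine ⟨n, Complex.isCoveringMap_exp.eqOn_of_comp_eqOn hs hf (hg.add continuousOn_const) ?_ ha hn⟩
  intro x hx
  apply Subtype.ext
  simp only [Function.comp_apply]
  rw [h x hx, Complex.exp_eq_exp_iff_exists_int]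
  exact ⟨-n, by push_cast; ring⟩

/-- The map `f` has local degree `n` at `z`: in logarithmic coordinates `w ↦ z + exp w` on the
source and `v ↦ f z + exp v` on the target, `f` lifts near `z` to a continuous map `m` of a left
half plane that turns the translation by `2πi` into the translation by `2πi n`. -/
def HasLocalDegree (f : ℂ → ℂ) (z : ℂ) (n : ℤ) : Prop :=
  ∃ (ρ : ℝ) (m : ℂ → ℂ), ContinuousOn m {w | w.re < ρ} ∧ ∀ w : ℂ, w.re < ρ →
    Complex.exp (m w) = f (z + Complex.exp w) - f z ∧
      m (w + 2 * Real.pi * Complex.I) = m w + n * (2 * Real.pi * Complex.I)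

theorem isPreconnected_re_lt (ρ : ℝ) : IsPreconnected {w : ℂ | w.re < ρ} :=
  (convex_halfSpace_re_lt ρ).isPreconnected

theorem re_add_two_pi_I (w : ℂ) : (w + 2 * Real.pi * Complex.I).re = w.re := by
  simp

theorem HasLocalDegree.unique {f : ℂ → ℂ} {z : ℂ} {n k : ℤ} (hn : HasLocalDegree f z n)
    (hk : HasLocalDegree f z k) : n = k := by
  obtain ⟨ρ, m, hm, h⟩ := hn
  obtain ⟨ρ', m', hm', h'⟩ := hk
  obtain ⟨j, hj⟩ := exists_int_of_exp_eqOn (isPreconnected_re_lt (min ρ ρ'))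
    (hm.mono fun w (hw : w.re < _) => lt_of_lt_of_le hw (min_le_left _ _))
    (hm'.mono fun w (hw : w.re < _) => lt_of_lt_of_le hw (min_le_right _ _))
    (fun w hw => by
      have hw : w.re < min ρ ρ' := hw
      rw [(h w (lt_of_lt_of_le hw (min_le_left _ _))).1,
        (h' w (lt_of_lt_of_le hw (min_le_right _ _))).1])
  have hw : ((min ρ ρ' - 1 : ℝ) : ℂ).re < min ρ ρ' := by
    rw [Complex.ofReal_re]; linarith
  set w : ℂ := ((min ρ ρ' - 1 : ℝ) : ℂ)
  have h1 := hj w hw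
  have h2 := hj (w + 2 * Real.pi * Complex.I) (by
    change (w + 2 * Real.pi * Complex.I).re < _
    rwa [re_add_two_pi_I])
  rw [(h w (lt_of_lt_of_le hw (min_le_left _ _))).2,
    (h' w (lt_of_lt_of_le hw (min_le_right _ _))).2, h1] at h2
  have h3 : ((n : ℂ) - k) * (2 * Real.pi * Complex.I) = 0 := by linear_combination h2
  have h4 := (mul_eq_zero.1 h3).resolve_right Complex.two_pi_I_ne_zero
  exact_mod_cast sub_eq_zero.1 h4

theorem tendsto_add_exp_re_atBot (z : ℂ) :
    Filter.Tendsto (fun w : ℂ => z + Complex.exp w) (Filter.comap Complex.re Filter.atBot)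
      (𝓝 z) := by
  have : Filter.Tendsto (fun w : ℂ => Complex.exp w) (Filter.comap Complex.re Filter.atBot)
      (𝓝 0) := by
    rw [tendsto_zero_iff_norm_tendsto_zero]
    simp only [Complex.norm_exp]
    exact Real.tendsto_exp_atBot.comp Filter.tendsto_comap
  simpa using this.const_add z

/-- In the logarithmic coordinate, the neighbourhoods of `z` become left half planes. -/
theorem exists_re_lt_of_eventually {z : ℂ} {q : ℂ → Prop} (h : ∀ᶠ x in 𝓝 z, q x) :
    ∃ ρ : ℝ, ∀ w : ℂ, w.re < ρ → q (z + Complex.exp w) := by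
  have := (tendsto_add_exp_re_atBot z).eventually h
  rw [Filter.eventually_comap] at this
  obtain ⟨ρ, hρ⟩ := Filter.eventually_atBot.1 this
  exact ⟨ρ, fun w hw => hρ _ hw.le w rfl⟩

theorem HasLocalDegree.congr {f g : ℂ → ℂ} {z : ℂ} {n : ℤ} (h : HasLocalDegree f z n)
    (hfg : f =ᶠ[𝓝 z] g) : HasLocalDegree g z n := by
  obtain ⟨ρ, m, hm, h⟩ := h
  obtain ⟨ρ', hρ'⟩ := exists_re_lt_of_eventually hfg
  refine ⟨min ρ ρ', m, hm.mono fun w (hw : w.re < _) => lt_of_lt_of_le hw (min_le_left _ _),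
    fun w hw => ?_⟩
  rw [← hρ' w (lt_of_lt_of_le hw (min_le_right _ _)), ← hfg.self_of_nhds]
  exact h w (lt_of_lt_of_le hw (min_le_left _ _))

/-- The local degree is multiplicative, because the lifts to logarithmic coordinates compose. -/
theorem HasLocalDegree.comp {f g : ℂ → ℂ} {z : ℂ} {n k : ℤ} (hg : HasLocalDegree g (f z) k)
    (hf : HasLocalDegree f z n) (hc : ContinuousAt f z) : HasLocalDegree (g ∘ f) z (k * n) := by
  obtain ⟨ρ, m, hm, h⟩ := hf
  obtain ⟨ρ', m', hm', h'⟩ := hg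
  -- Far enough to the left, the lift of `f` takes its values in the half plane where `g` lifts.
  have hev : ∀ᶠ x in 𝓝 z, ‖f x - f z‖ < Real.exp ρ' := by
    have := (hc.sub_const (f z)).norm
    exact this.eventually_lt continuousAt_const (by simpa using Real.exp_pos ρ')
  obtain ⟨ρ₁, hρ₁⟩ := exists_re_lt_of_eventually hev
  have hre : ∀ w : ℂ, w.re < min ρ ρ₁ → (m w).re < ρ' := fun w hw => by
    have h1 := hρ₁ w (lt_of_lt_of_le hw (min_le_right _ _))
    rw [← (h w (lt_of_lt_of_le hw (min_le_left _ _))).1, Complex.norm_exp] at h1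
    exact Real.exp_lt_exp.1 h1
  -- The lift `m'` of `g` turns the translation by `2πi j` into the translation by `2πi k j`,
  -- by induction for natural `j`, then for all integers.
  have hnat : ∀ (j : ℕ) (v : ℂ), v.re < ρ' →
      m' (v + j * (2 * Real.pi * Complex.I)) = m' v + j * (k * (2 * Real.pi * Complex.I)) := by
    intro j
    induction j with
    | zero => intro v _; simp
    | succ j ih =>
      intro v hv
      have e : v + ((j + 1 : ℕ) : ℂ) * (2 * Real.pi * Complex.I) =
          (v + 2 * Real.pi * Complex.I) + j * (2 * Real.pi * Complex.I) := by push_cast; ring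
      rw [e, ih _ (by rwa [re_add_two_pi_I]), (h' v hv).2]
      push_cast; ring
  have hint : ∀ (j : ℤ) (v : ℂ), v.re < ρ' →
      m' (v + j * (2 * Real.pi * Complex.I)) = m' v + j * (k * (2 * Real.pi * Complex.I)) := by
    intro j v hv
    obtain ⟨i, rfl | rfl⟩ := j.eq_nat_or_neg
    · simpa using hnat i v hv
    · have hv' : (v + ((-(i : ℤ) : ℤ) : ℂ) * (2 * Real.pi * Complex.I)).re < ρ' := by
        simpa using hv
      have := hnat i _ hv'
      have e : v + ((-(i : ℤ) : ℤ) : ℂ) * (2 * Real.pi * Complex.I) +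
        i * (2 * Real.pi * Complex.I) = v := by push_cast; ring
      rw [e] at this
      rw [this]; push_cast; ring
  refine ⟨min ρ ρ₁, m' ∘ m, hm'.comp (hm.mono fun w (hw : w.re < _) =>
    lt_of_lt_of_le hw (min_le_left _ _)) hre, fun w hw => ⟨?_, ?_⟩⟩
  · have h1 := (h w (lt_of_lt_of_le hw (min_le_left _ _))).1
    simp only [Function.comp_apply]
    rw [(h' _ (hre w hw)).1, h1]
    congr 2; ring
  · simp only [Function.comp_apply]
    rw [(h w (lt_of_lt_of_le hw (min_le_left _ _))).2, hint _ _ (hre w hw)]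
    push_cast; ring

theorem hasLocalDegree_add_const (c z : ℂ) : HasLocalDegree (fun x => x + c) z 1 :=
  ⟨0, id, continuousOn_id, fun w _ => ⟨by simp, by simp⟩⟩

theorem hasLocalDegree_id (z : ℂ) : HasLocalDegree (fun x => x) z 1 := by
  simpa using hasLocalDegree_add_const 0 z

theorem hasLocalDegree_conj_add_const (c z : ℂ) :
    HasLocalDegree (fun x => (starRingEnd ℂ) x + c) z (-1) := by
  refine ⟨0, starRingEnd ℂ, Complex.continuous_conj.continuousOn, fun w _ => ⟨?_, ?_⟩⟩
  · simp [← Complex.exp_conj]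
  · simp [map_ofNat (starRingEnd ℂ) 2]

/-- A local homeomorphism of the plane has a local degree, the same one at all nearby points: the
logarithms of `e (z' + exp w) - e z'` can be chosen continuously in `(z', w)`. -/
theorem exists_eventually_hasLocalDegree (e : OpenPartialHomeomorph ℂ ℂ) {z : ℂ}
    (hz : z ∈ e.source) : ∃ n : ℤ, ∀ᶠ z' in 𝓝 z, HasLocalDegree e z' n := by
  obtain ⟨R, hR, hball⟩ := Metric.isOpen_iff.1 e.open_source z hz
  -- With `z'` and `exp w` in balls of half the radius, `z' + exp w` stays in the source of `e`.
  have hR2 : 0 < R / 2 := by positivity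
  set U : Set (ℂ × ℂ) := Metric.ball z (R / 2) ×ˢ {w : ℂ | w.re < Real.log (R / 2)} with hU
  have hUc : Convex ℝ U := (convex_ball z _).prod (convex_halfSpace_re_lt _)
  have hUo : IsOpen U := Metric.isOpen_ball.prod (isOpen_lt Complex.continuous_re continuous_const)
  have hUn : U.Nonempty := ⟨(z, ((Real.log (R / 2) - 1 : ℝ) : ℂ)), by simp [hU, hR2]⟩
  have hm1 : ∀ x ∈ U, x.1 ∈ e.source := fun x hx => hball
    (Metric.ball_subset_ball (by linarith) hx.1)
  have hm2 : ∀ x ∈ U, x.1 + Complex.exp x.2 ∈ e.source := fun x hx => by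
    apply hball
    have h1 := hx.1
    have h2 : x.2.re < Real.log (R / 2) := hx.2
    rw [Real.lt_log_iff_exp_lt hR2, ← Complex.norm_exp] at h2
    rw [Metric.mem_ball, dist_eq_norm] at h1 ⊢
    calc ‖x.1 + Complex.exp x.2 - z‖ = ‖(x.1 - z) + Complex.exp x.2‖ := by congr 1; ring
      _ ≤ ‖x.1 - z‖ + ‖Complex.exp x.2‖ := norm_add_le _ _
      _ < R := by linarith
  have hcont : ContinuousOn (fun x : ℂ × ℂ => e (x.1 + Complex.exp x.2) - e x.1) U := by
    refine ContinuousOn.sub (e.continuousOn.comp (by fun_prop) hm2)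
      (e.continuousOn.comp (by fun_prop) hm1)
  have hne : (0 : ℂ) ∉ (fun x : ℂ × ℂ => e (x.1 + Complex.exp x.2) - e x.1) '' U := by
    rintro ⟨x, hx, h0⟩
    have := e.injOn (hm2 x hx) (hm1 x hx) (sub_eq_zero.1 h0)
    exact Complex.exp_ne_zero x.2 (by linear_combination this)
  have hsc : IsSimplyConnected U := by
    have := hUc.contractibleSpace hUn
    exact SimplyConnectedSpace.ofContractible U
  obtain ⟨m, hm, hexp⟩ := Complex.exists_continuousOn_eqOn_exp_comp hsc hUo hcont hne
  -- The degree is read off at each point of a connected set, so that it is constant.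
  have hshift : ∀ x ∈ U, (x.1, x.2 + 2 * Real.pi * Complex.I) ∈ U := fun x hx =>
    ⟨hx.1, by
      change (x.2 + 2 * Real.pi * Complex.I).re < _
      rw [re_add_two_pi_I]; exact hx.2⟩
  obtain ⟨n, hn⟩ := exists_int_of_exp_eqOn hUc.isPreconnected
    (f := fun x => m (x.1, x.2 + 2 * Real.pi * Complex.I)) (g := m)
    (hm.comp (by fun_prop) hshift) hm (fun x hx => by
      have h1 := hexp (hshift x hx)
      have h2 := hexp hx
      simp only [Function.comp_apply] at h1 h2
      rw [h1, h2, Complex.exp_periodic x.2])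
  refine ⟨n, Filter.mem_of_superset (Metric.ball_mem_nhds z hR2) fun z' hz' =>
    ⟨Real.log (R / 2), fun w => m (z', w), hm.comp (by fun_prop) fun w hw => ⟨hz', hw⟩,
      fun w hw => ⟨hexp (show (z', w) ∈ U from ⟨hz', hw⟩), hn (z', w) ⟨hz', hw⟩⟩⟩⟩

theorem exists_hasLocalDegree (e : OpenPartialHomeomorph ℂ ℂ) {z : ℂ}
    (hz : z ∈ e.source) : ∃ n : ℤ, HasLocalDegree e z n :=
  (exists_eventually_hasLocalDegree e hz).imp fun _ h => h.self_of_nhds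

/-- The local degree of a homeomorphism is invertible in `ℤ`. -/
theorem exists_hasLocalDegree_one_or_neg_one (e : OpenPartialHomeomorph ℂ ℂ) {z : ℂ}
    (hz : z ∈ e.source) : HasLocalDegree e z 1 ∨ HasLocalDegree e z (-1) := by
  obtain ⟨n, hn⟩ := exists_hasLocalDegree e hz
  -- The degrees of `e` and of its inverse multiply to the degree of the identity.
  obtain ⟨k, hk⟩ := exists_hasLocalDegree e.symm (e.map_source hz)
  have h1 := (hk.comp hn (e.continuousAt hz)).congr (e.eventually_left_inverse hz)
  have h2 := h1.unique (hasLocalDegree_id z)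
  rcases Int.eq_one_or_neg_one_of_mul_eq_one' h2 with ⟨-, rfl⟩ | ⟨-, rfl⟩
  · exact .inl hn
  · exact .inr hn

/-- The logarithms along small circles in `PreservesOrientationAt` are the restrictions of the lift
of `e` to the vertical lines `re w = log r`. -/
theorem preservesOrientationAt_iff (e : OpenPartialHomeomorph ℂ ℂ) {z : ℂ}
    (hz : z ∈ e.source) : PreservesOrientationAt e z ↔ HasLocalDegree e z 1 := by
  have hlog : ∀ {r : ℝ}, 0 < r → ∀ t : ℝ,
      Complex.exp ((Real.log r : ℂ) + t * Complex.I) = r * Complex.exp (t * Complex.I) := by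
    intro r hr t
    rw [Complex.exp_add, ← Complex.ofReal_exp, Real.exp_log hr]
  have hre : ∀ r t : ℝ, ((Real.log r : ℂ) + t * Complex.I).re = Real.log r := by simp
  constructor
  · intro h
    obtain ⟨n, ρ, m, hm, hmw⟩ := exists_hasLocalDegree e hz
    have hsmall : ∀ᶠ r : ℝ in 𝓝[>] 0, r < Real.exp ρ :=
      nhdsWithin_le_nhds (Iio_mem_nhds (Real.exp_pos ρ))
    obtain ⟨r, ⟨⟨L, hL, hLe, hLp⟩, hr⟩, hr0⟩ :=
      ((h.and hsmall).and self_mem_nhdsWithin).exists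
    have hr0 : 0 < r := hr0
    have hρ : Real.log r < ρ := (Real.log_lt_iff_lt_exp hr0).2 hr
    have hin : ∀ t : ℝ, ((Real.log r : ℂ) + t * Complex.I).re < ρ := fun t => by rwa [hre]
    obtain ⟨j, hj⟩ := exists_int_of_exp_eqOn (isPreconnected_univ (α := ℝ))
      (f := fun t : ℝ => m ((Real.log r : ℂ) + t * Complex.I)) (g := L)
      (hm.comp (by fun_prop) fun t _ => hin t) hL.continuousOn (fun t _ => by
        rw [(hmw _ (hin t)).1, hlog hr0, hLe t])
    have h0 := hj 0 trivial
    have h1 := hj (2 * Real.pi) trivial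
    have h2 := (hmw _ (hin 0)).2
    simp only [Complex.ofReal_zero, zero_mul, add_zero] at h0 h2
    push_cast at h1
    rw [h2, hLp, h0] at h1
    have h3 : ((n : ℂ) - 1) * (2 * Real.pi * Complex.I) = 0 := by linear_combination h1
    have h4 := (mul_eq_zero.1 h3).resolve_right Complex.two_pi_I_ne_zero
    have h5 : n = 1 := by exact_mod_cast sub_eq_zero.1 h4
    exact h5 ▸ ⟨ρ, m, hm, hmw⟩
  · rintro ⟨ρ, m, hm, hmw⟩
    have hsmall : ∀ᶠ r : ℝ in 𝓝[>] 0, r < Real.exp ρ :=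
      nhdsWithin_le_nhds (Iio_mem_nhds (Real.exp_pos ρ))
    filter_upwards [hsmall, self_mem_nhdsWithin] with r hr hr0
    have hr0 : 0 < r := hr0
    have hρ : Real.log r < ρ := (Real.log_lt_iff_lt_exp hr0).2 hr
    have hin : ∀ t : ℝ, ((Real.log r : ℂ) + t * Complex.I).re < ρ := fun t => by rwa [hre]
    refine ⟨fun t : ℝ => m ((Real.log r : ℂ) + t * Complex.I), ?_, fun t => ?_, ?_⟩
    · exact hm.comp_continuous (by fun_prop) hin
    · rw [(hmw _ (hin t)).1, hlog hr0]
    · have := (hmw _ (hin 0)).2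
      simpa using this

/-! ### Local orientations -/

section LocalOrientation

variable {M : Type*} [TopologicalSpace M]

theorem mem_source_transition {x : M} (φ ψ : ChartAt M x) :
    φ.1 x ∈ (φ.1.symm.trans ψ.1).source := by
  simp [φ.2, ψ.2]

theorem preservesOrientationAt_transition_iff {x : M} (φ ψ : ChartAt M x) :
    PreservesOrientationAt (ψ.1 ∘ φ.1.symm) (φ.1 x) ↔
      HasLocalDegree (ψ.1 ∘ φ.1.symm) (φ.1 x) 1 :=
  preservesOrientationAt_iff (φ.1.symm.trans ψ.1) (mem_source_transition φ ψ)

/-- Local degrees of transition maps multiply: the cocycle rule for three charts. -/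
theorem hasLocalDegree_transition_comp {x : M} (φ ψ χ : ChartAt M x) {n k : ℤ}
    (h : HasLocalDegree (ψ.1 ∘ φ.1.symm) (φ.1 x) n)
    (h' : HasLocalDegree (χ.1 ∘ ψ.1.symm) (ψ.1 x) k) :
    HasLocalDegree (χ.1 ∘ φ.1.symm) (φ.1 x) (k * n) := by
  have hx : φ.1.symm (φ.1 x) = x := φ.1.left_inv φ.2
  have hc : ContinuousAt (ψ.1 ∘ φ.1.symm) (φ.1 x) :=
    (φ.1.symm.trans ψ.1).continuousAt (mem_source_transition φ ψ)
  have h'' : HasLocalDegree (χ.1 ∘ ψ.1.symm) ((ψ.1 ∘ φ.1.symm) (φ.1 x)) k := by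
    simpa [hx] using h'
  refine (h''.comp h hc).congr ?_
  filter_upwards [(φ.1.symm.trans ψ.1).open_source.mem_nhds (mem_source_transition φ ψ)] with y hy
  have hy' : φ.1.symm y ∈ ψ.1.source := by
    rw [OpenPartialHomeomorph.trans_source] at hy
    exact hy.2
  simp [ψ.1.left_inv hy']

theorem hasLocalDegree_transition_self {x : M} (φ : ChartAt M x) :
    HasLocalDegree (φ.1 ∘ φ.1.symm) (φ.1 x) 1 := by
  refine (hasLocalDegree_id (φ.1 x)).congr ?_
  filter_upwards [φ.1.open_target.mem_nhds (φ.1.map_source φ.2)] with y hy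
  simp [φ.1.right_inv hy]

/-- Having a transition map of degree one is an equivalence relation on the charts at `x`, so that
charts define the same local orientation only if they are directly related by it. -/
theorem localOrientation_mk_eq_iff {x : M} (φ ψ : ChartAt M x) :
    (Quot.mk _ φ : LocalOrientation M x) = Quot.mk _ ψ ↔
      HasLocalDegree (ψ.1 ∘ φ.1.symm) (φ.1 x) 1 := by
  have heq : Equivalence fun φ ψ : ChartAt M x =>
      PreservesOrientationAt (ψ.1 ∘ φ.1.symm) (φ.1 x) := by
    constructor
    · intro φ
      rw [preservesOrientationAt_transition_iff]
      exact hasLocalDegree_transition_self φ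
    · intro φ ψ h
      rw [preservesOrientationAt_transition_iff] at h ⊢
      obtain ⟨k, hk⟩ := exists_hasLocalDegree (ψ.1.symm.trans φ.1) (mem_source_transition ψ φ)
      have h1 := (hasLocalDegree_transition_comp φ ψ φ h hk).unique
        (hasLocalDegree_transition_self φ)
      obtain rfl : k = 1 := by simpa using h1
      exact hk
    · intro φ ψ χ h h'
      rw [preservesOrientationAt_transition_iff] at h h' ⊢
      simpa using hasLocalDegree_transition_comp φ ψ χ h h'
  rw [← preservesOrientationAt_transition_iff]
  exact heq.quot_mk_eq_iff φ ψ

theorem orientationSpace_mk_congr {x y : M} (hxy : x = y) {φ : OpenPartialHomeomorph M ℂ}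
    (hx : x ∈ φ.source) (hy : y ∈ φ.source) :
    (⟨x, Quot.mk _ ⟨φ, hx⟩⟩ : OrientationSpace M) = ⟨y, Quot.mk _ ⟨φ, hy⟩⟩ := by
  subst hxy
  rfl

variable {f : ℂ → M} (hf : IsLocalHomeomorph f)

/-- The orientation of `M` at `f z` obtained by pushing forward the standard orientation of the
plane at `z` by the local homeomorphism `f`. -/
noncomputable def pushOrientation (z : ℂ) : OrientationSpace M :=
  ⟨f z, Quot.mk _ ⟨hf.localInverseAt z, by simp⟩⟩

theorem pushOrientation_eq_mk_iff (z : ℂ) {φ : OpenPartialHomeomorph M ℂ} (hφ : f z ∈ φ.source) :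
    pushOrientation hf z = ⟨f z, Quot.mk _ ⟨φ, hφ⟩⟩ ↔ HasLocalDegree (φ ∘ f) z 1 := by
  have key := localOrientation_mk_eq_iff (x := f z) ⟨hf.localInverseAt z, by simp⟩ ⟨φ, hφ⟩
  rw [IsLocalHomeomorph.localInverseAt_symm, IsLocalHomeomorph.localInverseAt_apply_self] at key
  rw [← key, pushOrientation]
  constructor
  · intro h
    exact eq_of_heq (Sigma.mk.inj h).2
  · intro h
    rw [h]

theorem pushOrientation_mem_chartSheet_iff (z : ℂ) (φ : OpenPartialHomeomorph M ℂ) (V : Set M) :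
    pushOrientation hf z ∈ chartSheet φ V ↔
      f z ∈ φ.source ∧ f z ∈ V ∧ HasLocalDegree (φ ∘ f) z 1 := by
  constructor
  · rintro ⟨y, hy, hyV, h⟩
    obtain rfl : f z = y := congrArg Sigma.fst h
    exact ⟨hy, hyV, (pushOrientation_eq_mk_iff hf z hy).1 h⟩
  · rintro ⟨hs, hV, hd⟩
    exact ⟨f z, hs, hV, (pushOrientation_eq_mk_iff hf z hs).2 hd⟩

/-- The local homeomorphism `φ ∘ f` of the plane, as a partial homeomorphism near `z`. -/
theorem exists_openPartialHomeomorph_comp {f : ℂ → M} (hf : IsLocalHomeomorph f) (z : ℂ)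
    {φ : OpenPartialHomeomorph M ℂ}
    (hφ : f z ∈ φ.source) : ∃ e : OpenPartialHomeomorph ℂ ℂ, z ∈ e.source ∧ ⇑e = φ ∘ f := by
  obtain ⟨c, hc, hfc⟩ := hf z
  exact ⟨c.trans φ, by simp [hc, ← hfc, hφ], by simp [hfc]⟩

/-- Continuity is the local constancy of the degree of `φ ∘ f`, for every chart `φ`. -/
theorem continuous_pushOrientation : Continuous (pushOrientation hf) := by
  refine continuous_generateFrom_iff.2 ?_
  rintro _ ⟨φ, V, hV, rfl⟩
  rw [isOpen_iff_mem_nhds]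
  intro z hz
  obtain ⟨hs, hzV, hd⟩ := (pushOrientation_mem_chartSheet_iff hf z φ V).1 hz
  obtain ⟨e, he, hef⟩ := exists_openPartialHomeomorph_comp hf z hs
  obtain ⟨n, hn⟩ := exists_eventually_hasLocalDegree e he
  rw [hef] at hn
  obtain rfl : n = 1 := hn.self_of_nhds.unique hd
  filter_upwards [hn, hf.continuous.continuousAt.preimage_mem_nhds (φ.open_source.mem_nhds hs),
    hf.continuous.continuousAt.preimage_mem_nhds (hV.mem_nhds hzV)] with z' h1 h2 h3
  exact (pushOrientation_mem_chartSheet_iff hf z' φ V).2 ⟨h2, h3, h1⟩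

/-- Near `z`, a local inverse of `f` at `z` undoes `f`. -/
theorem eventually_localInverseAt_apply (z : ℂ) :
    ∀ᶠ y in 𝓝 z, hf.localInverseAt z (f y) = y := by
  filter_upwards [(hf.localInverseAt z).open_target.mem_nhds
    (hf.self_mem_localInverseAt_target (x := z))] with y hy
  have := (hf.localInverseAt z).right_inv hy
  rwa [IsLocalHomeomorph.localInverseAt_symm] at this

/-- Near `z`, the image is a sheet of the chart inverse to `f`, which is open by definition. -/
theorem isOpenMap_pushOrientation : IsOpenMap (pushOrientation hf) := by
  intro U hU
  rw [isOpen_iff_mem_nhds]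
  rintro _ ⟨z, hz, rfl⟩
  set φ := hf.localInverseAt z with hφ
  have hW : IsOpen (f '' (U ∩ φ.target)) := hf.isOpenMap _ (hU.inter φ.open_target)
  have hzt : z ∈ φ.target := hf.self_mem_localInverseAt_target
  have hsymm : ⇑φ.symm = f := hf.localInverseAt_symm z
  have hdeg : ∀ y ∈ φ.target, HasLocalDegree (φ ∘ f) y 1 := fun y hy => by
    refine (hasLocalDegree_id y).congr ?_
    filter_upwards [φ.open_target.mem_nhds hy] with x hx
    have := φ.right_inv hx
    rw [hsymm] at this
    simp [this]
  have hsrc : ∀ y ∈ φ.target, f y ∈ φ.source := fun y hy => by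
    rw [← hsymm]; exact φ.map_target hy
  refine Filter.mem_of_superset ((TopologicalSpace.isOpen_generateFrom_of_mem
    ⟨φ, _, hW, rfl⟩ : IsOpen (chartSheet φ (f '' (U ∩ φ.target)))).mem_nhds
    ((pushOrientation_mem_chartSheet_iff hf z φ _).2
      ⟨hsrc z hzt, ⟨z, ⟨hz, hzt⟩, rfl⟩, hdeg z hzt⟩)) ?_
  rintro _ ⟨_, hy, ⟨y, ⟨hyU, hyt⟩, rfl⟩, rfl⟩
  exact ⟨y, hyU, (pushOrientation_eq_mk_iff hf y hy).2 (hdeg y hyt)⟩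

end LocalOrientation

/-! ### Quotients of the plane by a lattice and by a glide reflection -/

section Glide

/-- The glide reflection `x + iy ↦ (x + 1) - iy`. -/
noncomputable def glide (z : ℂ) : ℂ := (starRingEnd ℂ) z + 1

variable {E M : Type*} [TopologicalSpace E] [TopologicalSpace M]

/-- The maps `p : ℂ → E` and `q : E → M` present `E` as the torus `ℂ / (2ℤ + iℤ)` and `M` as the
quotient of this torus by the involution induced by the glide reflection, that is, as a Klein
bottle. -/
structure IsGlideModel (p : ℂ → E) (q : E → M) : Prop where
  continuous_left : Continuous p
  continuous_right : Continuous q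
  surjective_left : Function.Surjective p
  surjective_right : Function.Surjective q
  left_eq_iff : ∀ z z', p z = p z' ↔ ∃ m n : ℤ, z' = z + 2 * m + n * Complex.I
  right_eq_iff : ∀ z z', q (p z) = q (p z') ↔ p z = p z' ∨ p (glide z) = p z'

/-- A quotient map whose fibres are the orbits of a family of continuous maps and which is locally
injective is a local homeomorphism. -/
theorem isLocalHomeomorph_of_orbits {X Y ι : Type*} [TopologicalSpace X] [TopologicalSpace Y]
    {f : X → Y} (hf : IsQuotientMap f) (γ : ι → X → X) (hγ : ∀ i, Continuous (γ i))
    (horb : ∀ x x', f x = f x' ↔ ∃ i, x' = γ i x)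
    (hinj : ∀ x, ∃ U ∈ 𝓝 x, InjOn f U) : IsLocalHomeomorph f := by
  have hopen : IsOpenMap f := by
    intro U hU
    rw [← hf.isOpen_preimage]
    have : f ⁻¹' (f '' U) = ⋃ i, γ i ⁻¹' U := by
      ext x
      simp only [mem_preimage, mem_image, mem_iUnion]
      constructor
      · rintro ⟨y, hy, h⟩
        obtain ⟨i, rfl⟩ := (horb x y).1 h.symm
        exact ⟨i, hy⟩
      · rintro ⟨i, hi⟩
        exact ⟨γ i x, hi, ((horb x _).2 ⟨i, rfl⟩).symm⟩
    rw [this]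
    exact isOpen_iUnion fun i => hU.preimage (hγ i)
  rw [isLocalHomeomorph_iff_isOpenEmbedding_restrict]
  intro x
  obtain ⟨U, hU, hUinj⟩ := hinj x
  refine ⟨interior U, interior_mem_nhds.2 hU, ?_⟩
  refine IsOpenEmbedding.of_continuous_injective_isOpenMap
    (hf.continuous.comp continuous_subtype_val) ?_ (hopen.comp isOpen_interior.isOpenMap_subtype_val)
  exact (hUinj.mono interior_subset).injective

namespace IsGlideModel

variable {p : ℂ → E} {q : E → M} (h : IsGlideModel p q)
include h

theorem left_add (z : ℂ) (m n : ℤ) : p (z + 2 * m + n * Complex.I) = p z :=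
  ((h.left_eq_iff _ _).2 ⟨m, n, rfl⟩).symm

theorem right_glide (z : ℂ) : q (p (glide z)) = q (p z) :=
  ((h.right_eq_iff _ _).2 (.inr rfl)).symm

theorem exists_mem_rect (e : E) : ∃ z ∈ Icc (0 : ℝ) 2 ×ℂ Icc (0 : ℝ) 1, p z = e := by
  obtain ⟨z, rfl⟩ := h.surjective_left e
  refine ⟨z + 2 * (-⌊z.re / 2⌋ : ℤ) + (-⌊z.im⌋ : ℤ) * Complex.I, ?_, h.left_add _ _ _⟩
  have h1 := Int.floor_le (z.re / 2)
  have h2 := Int.lt_floor_add_one (z.re / 2)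
  have h3 := Int.floor_le z.im
  have h4 := Int.lt_floor_add_one z.im
  rw [Complex.mem_reProdIm]
  simp only [Complex.add_re, Complex.add_im, Complex.mul_re, Complex.mul_im, Complex.intCast_re,
    Complex.intCast_im, Complex.I_re, Complex.I_im, Complex.re_ofNat, Complex.im_ofNat, mem_Icc]
  push_cast
  constructor <;> constructor <;> linarith

theorem compactSpace : CompactSpace E := by
  refine ⟨?_⟩
  have : p '' (Icc (0 : ℝ) 2 ×ℂ Icc (0 : ℝ) 1) = univ :=
    eq_univ_of_forall fun e => h.exists_mem_rect e
  rw [← this]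
  exact (isCompact_Icc.reProdIm isCompact_Icc).image h.continuous_left

theorem isQuotientMap_left [T2Space E] : IsQuotientMap p := by
  have : CompactSpace (Icc (0 : ℝ) 2 ×ℂ Icc (0 : ℝ) 1 : Set ℂ) :=
    isCompact_iff_compactSpace.1 (isCompact_Icc.reProdIm isCompact_Icc)
  refine IsQuotientMap.of_comp continuous_subtype_val h.continuous_left
    (IsQuotientMap.of_surjective_continuous (X := (Icc (0 : ℝ) 2 ×ℂ Icc (0 : ℝ) 1 : Set ℂ)) ?_
      (h.continuous_left.comp continuous_subtype_val))
  intro e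
  obtain ⟨z, hz, rfl⟩ := h.exists_mem_rect e
  exact ⟨⟨z, hz⟩, rfl⟩

/-- The fibres of `q ∘ p` are the orbits of the group generated by the glide reflection and the
vertical translation; the Boolean tells whether the glide reflection is applied. -/
theorem right_eq_iff_exists (z z' : ℂ) : q (p z) = q (p z') ↔
    ∃ i : Bool × ℤ × ℤ, z' = (cond i.1 (glide z) z) + 2 * i.2.1 + i.2.2 * Complex.I := by
  rw [h.right_eq_iff, h.left_eq_iff, h.left_eq_iff]
  constructor
  · rintro (⟨m, n, rfl⟩ | ⟨m, n, rfl⟩)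
    · exact ⟨(false, m, n), rfl⟩
    · exact ⟨(true, m, n), rfl⟩
  · rintro ⟨⟨b, m, n⟩, rfl⟩
    cases b
    · exact .inl ⟨m, n, rfl⟩
    · exact .inr ⟨m, n, rfl⟩

/-- Two points at distance less than one with the same image in the Klein bottle are equal. -/
theorem injOn_ball (z : ℂ) : InjOn (q ∘ p) (Metric.ball z (1 / 2)) := by
  intro x hx y hy hxy
  have hd : ‖y - x‖ < 1 := by
    rw [← dist_eq_norm]
    have := dist_triangle_right y x z
    rw [Metric.mem_ball] at hx hy
    linarith
  have hre := (Complex.abs_re_le_norm (y - x)).trans_lt hd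
  have him := (Complex.abs_im_le_norm (y - x)).trans_lt hd
  obtain ⟨⟨b, m, n⟩, rfl⟩ := (h.right_eq_iff_exists x y).1 hxy
  rw [abs_lt] at hre him
  cases b
  · simp at hre him
    have hm : m = 0 := by
      have h1 : (-1 : ℤ) < 2 * m := by
        have : ((-1 : ℤ) : ℝ) < ((2 * m : ℤ) : ℝ) := by push_cast; exact hre.1
        exact_mod_cast this
      have h2 : 2 * m < (1 : ℤ) := by
        have : ((2 * m : ℤ) : ℝ) < ((1 : ℤ) : ℝ) := by push_cast; exact hre.2
        exact_mod_cast this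
      lia
    have hn : n = 0 := by
      have h1 : (-1 : ℤ) < n := by exact_mod_cast him.1
      have h2 : n < (1 : ℤ) := by exact_mod_cast him.2
      lia
    simp [hm, hn]
  -- An odd number of glides moves the real part by an odd integer.
  · exfalso
    simp [glide] at hre him
    have h1 : (-1 : ℤ) < 1 + 2 * m := by
      have : (-1 : ℝ) < 1 + 2 * m := by linarith [hre.1]
      exact_mod_cast this
    have h2 : 1 + 2 * m < (1 : ℤ) := by
      have : (1 : ℝ) + 2 * m < 1 := by linarith [hre.2]
      exact_mod_cast this
    lia

theorem isLocalHomeomorph_left [T2Space E] : IsLocalHomeomorph p := by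
  refine isLocalHomeomorph_of_orbits h.isQuotientMap_left
    (fun (i : ℤ × ℤ) z => z + 2 * i.1 + i.2 * Complex.I) (fun i => by fun_prop) (fun x x' => ?_)
    fun x => ⟨_, Metric.ball_mem_nhds x one_half_pos, (h.injOn_ball x).of_comp⟩
  rw [h.left_eq_iff, Prod.exists]

theorem isQuotientMap_comp [T2Space E] [T2Space M] : IsQuotientMap (q ∘ p) := by
  have := h.compactSpace
  exact (IsQuotientMap.of_surjective_continuous h.surjective_right h.continuous_right).comp
    h.isQuotientMap_left

theorem isLocalHomeomorph_comp [T2Space E] [T2Space M] : IsLocalHomeomorph (q ∘ p) := by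
  refine isLocalHomeomorph_of_orbits h.isQuotientMap_comp
    (fun (i : Bool × ℤ × ℤ) z => (cond i.1 (glide z) z) + 2 * i.2.1 + i.2.2 * Complex.I)
    (fun i => ?_) h.right_eq_iff_exists
    fun x => ⟨_, Metric.ball_mem_nhds x one_half_pos, h.injOn_ball x⟩
  rcases i with ⟨_ | _, m, n⟩
  · simp only [cond_false]; fun_prop
  · simp only [cond_true, glide]
    exact ((Complex.continuous_conj.add continuous_const).add continuous_const).add
      continuous_const

theorem isLocalHomeomorph_right [T2Space E] [T2Space M] : IsLocalHomeomorph q := by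
  have := (isLocalHomeomorph_iff_isLocalHomeomorphOn_univ.1 h.isLocalHomeomorph_comp).of_comp_right
    (isLocalHomeomorph_iff_isLocalHomeomorphOn_univ.1 h.isLocalHomeomorph_left)
  rw [image_univ, h.surjective_left.range_eq] at this
  exact isLocalHomeomorph_iff_isLocalHomeomorphOn_univ.2 this

theorem isTopologicalSurface [T2Space E] [T2Space M] : IsTopologicalSurface M := by
  refine ⟨inferInstance, h.isQuotientMap_comp.secondCountableTopology
    h.isLocalHomeomorph_comp.isOpenMap, fun x => ?_⟩
  obtain ⟨z, rfl⟩ := h.isQuotientMap_comp.surjective x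
  exact ⟨h.isLocalHomeomorph_comp.localInverseAt z,
    h.isLocalHomeomorph_comp.apply_self_mem_localInverseAt_source⟩

theorem left_glide_ne (z : ℂ) : p (glide z) ≠ p z := by
  rw [Ne, h.left_eq_iff]
  rintro ⟨m, n, hz⟩
  have := congrArg Complex.re hz
  simp [glide] at this
  have h1 : 1 + 2 * m = 0 := by
    have : (1 : ℝ) + 2 * m = 0 := by linarith
    exact_mod_cast this
  lia

theorem ncard_fibre (x : M) : (q ⁻¹' {x}).ncard = 2 := by
  obtain ⟨e, rfl⟩ := h.surjective_right x
  obtain ⟨z, rfl⟩ := h.surjective_left e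
  have : q ⁻¹' {q (p z)} = {p (glide z), p z} := by
    ext e
    obtain ⟨z', rfl⟩ := h.surjective_left e
    simp only [mem_preimage, mem_singleton_iff, mem_insert_iff]
    rw [eq_comm, h.right_eq_iff, eq_comm (a := p z), eq_comm (a := p (glide z)), or_comm]
  rw [this, ncard_pair (h.left_glide_ne z)]

/-- Invariance under the inverse of the glide reflection. -/
theorem comp_conj_sub_one (z : ℂ) : (q ∘ p) ((starRingEnd ℂ) z + (-1)) = (q ∘ p) z := by
  have := h.right_glide ((starRingEnd ℂ) z + (-1))
  simpa [glide] using this.symm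

/-- The glide reflection reverses the orientations pushed forward from the plane. -/
theorem hasLocalDegree_comp_glide {z : ℂ} {φ : M → ℂ} {n : ℤ}
    (hd : HasLocalDegree (φ ∘ (q ∘ p)) z n) : HasLocalDegree (φ ∘ (q ∘ p)) (glide z) (-n) := by
  have h1 : HasLocalDegree (φ ∘ (q ∘ p)) ((starRingEnd ℂ) (glide z) + (-1)) n := by
    simpa [glide] using hd
  have h2 := HasLocalDegree.comp (f := fun w => (starRingEnd ℂ) w + (-1)) h1
    (hasLocalDegree_conj_add_const (-1) (glide z))
    (Complex.continuous_conj.add continuous_const).continuousAt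
  rw [mul_neg_one] at h2
  refine h2.congr (.of_forall fun w => ?_)
  simp only [Function.comp_def]
  exact congrArg φ (h.comp_conj_sub_one w)

/-- Translations preserve the orientation of the plane and the glide reflection reverses it; hence
two points over the same point of `M` induce the same orientation exactly when they have the same
image in the torus. -/
theorem pushOrientation_eq_iff [T2Space E] [T2Space M] (z z' : ℂ) :
    pushOrientation h.isLocalHomeomorph_comp z = pushOrientation h.isLocalHomeomorph_comp z' ↔
      p z = p z' := by
  set hP := h.isLocalHomeomorph_comp
  have hself : ∀ z, HasLocalDegree (hP.localInverseAt z ∘ (q ∘ p)) z 1 := fun z =>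
    (hasLocalDegree_id z).congr ((eventually_localInverseAt_apply hP z).mono fun y hy => hy.symm)
  have htrans : ∀ z z', p z = p z' → pushOrientation hP z' = pushOrientation hP z := by
    intro z z' hz
    obtain ⟨m, n, hmn⟩ := (h.left_eq_iff z' z).1 hz.symm
    have hx : (q ∘ p) z' = (q ∘ p) z := congrArg q hz.symm
    have hs : (q ∘ p) z' ∈ (hP.localInverseAt z).source := by
      rw [hx]
      exact hP.apply_self_mem_localInverseAt_source
    rw [(pushOrientation_eq_mk_iff hP z' hs).2]
    · exact (orientationSpace_mk_congr hx hs _)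
    · have h1 : HasLocalDegree (hP.localInverseAt z ∘ (q ∘ p))
          (z' + (2 * m + n * Complex.I)) 1 := by
        rw [← add_assoc, ← hmn]; exact hself z
      have h2 := HasLocalDegree.comp (f := fun w => w + (2 * m + n * Complex.I)) h1
        (hasLocalDegree_add_const (2 * m + n * Complex.I) z')
        (by fun_prop)
      refine h2.congr (.of_forall fun w => ?_)
      simp only [Function.comp_apply, ← add_assoc, h.left_add]
  refine ⟨fun ho => ?_, fun hz => (htrans z z' hz).symm⟩
  have hx : q (p z) = q (p z') := congrArg Sigma.fst ho
  refine ((h.right_eq_iff z z').1 hx).resolve_right fun hg => ?_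
  have h1 : pushOrientation hP z ∈ chartSheet (hP.localInverseAt z) univ :=
    (pushOrientation_mem_chartSheet_iff hP _ _ _).2
      ⟨hP.apply_self_mem_localInverseAt_source, trivial, hself z⟩
  rw [ho, htrans _ _ hg] at h1
  have h2 := ((pushOrientation_mem_chartSheet_iff hP _ _ _).1 h1).2.2
  exact absurd (h2.unique (h.hasLocalDegree_comp_glide (hself z))) (by norm_num)

/-- A chart at `q (p z)` has degree `1` at `z` or at the image of `z` by the glide reflection. -/
theorem surjective_pushOrientation [T2Space E] [T2Space M] :
    Function.Surjective (pushOrientation h.isLocalHomeomorph_comp) := by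
  rintro ⟨x, o⟩
  obtain ⟨⟨φ, hφ⟩, rfl⟩ := Quot.exists_rep o
  obtain ⟨z, rfl⟩ := h.isQuotientMap_comp.surjective x
  set hP := h.isLocalHomeomorph_comp
  obtain ⟨e, he, hef⟩ := exists_openPartialHomeomorph_comp hP z hφ
  rcases exists_hasLocalDegree_one_or_neg_one e he with hd | hd
  · rw [hef] at hd
    exact ⟨z, (pushOrientation_eq_mk_iff hP z hφ).2 hd⟩
  · rw [hef] at hd
    have h1 := h.hasLocalDegree_comp_glide hd
    have hx : (q ∘ p) (glide z) = (q ∘ p) z := h.right_glide z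
    obtain ⟨y, hy, -, hyz⟩ := (pushOrientation_mem_chartSheet_iff hP (glide z) φ univ).2
      ⟨by rwa [hx], trivial, by simpa using h1⟩
    obtain rfl : y = (q ∘ p) z := by
      rw [← hx]; exact (congrArg Sigma.fst hyz).symm
    exact ⟨glide z, hyz⟩

/-- The torus is the orientation double covering of the Klein bottle: the point `p z` corresponds
to the image at `q (p z)` of the standard orientation of the plane at `z`. -/
theorem isOrientationDoubleCover [T2Space E] [T2Space M] : IsOrientationDoubleCover q := by
  have hE := h.compactSpace
  refine ⟨isLocalHomeomorph_iff_isCoveringMap.1 h.isLocalHomeomorph_right, h.ncard_fibre, ?_⟩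
  set hP := h.isLocalHomeomorph_comp
  have hinv : ∀ z, pushOrientation hP (Function.surjInv h.surjective_left (p z)) =
      pushOrientation hP z := fun z =>
    (h.pushOrientation_eq_iff _ _).2 (Function.surjInv_eq h.surjective_left (p z))
  set F : E → OrientationSpace M :=
    fun e => pushOrientation hP (Function.surjInv h.surjective_left e)
  have hF : F ∘ p = pushOrientation hP := funext hinv
  have hbij : Function.Bijective F := by
    constructor
    · intro e e' hee
      obtain ⟨z, rfl⟩ := h.surjective_left e
      obtain ⟨z', rfl⟩ := h.surjective_left e'
      exact (h.pushOrientation_eq_iff z z').1 (by rw [← hinv z, ← hinv z']; exact hee)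
    · refine Function.Surjective.of_comp (g := p) ?_
      rw [hF]
      exact h.surjective_pushOrientation
  have hcont : Continuous F := by
    rw [h.isQuotientMap_left.continuous_iff, hF]
    exact continuous_pushOrientation hP
  have hopen : IsOpenMap F := by
    intro U hU
    rw [← image_preimage_eq U h.surjective_left, ← image_comp, hF]
    exact isOpenMap_pushOrientation hP _ (hU.preimage h.continuous_left)
  refine ⟨(Equiv.ofBijective F hbij).toHomeomorphOfContinuousOpen hcont hopen, fun e => ?_⟩
  change q (p (Function.surjInv h.surjective_left e)) = q e
  rw [Function.surjInv_eq h.surjective_left e]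

end IsGlideModel

end Glide

namespace IsGlideModel

variable {E M : Type*} [TopologicalSpace E] [TopologicalSpace M]
  {p : ℂ → E} {q : E → M} (h : IsGlideModel p q)
include h

/-- The unit square is a fundamental domain of the group generated by the glide reflection and the
vertical translation. -/
theorem exists_mem_square (x : M) : ∃ z ∈ Icc (0 : ℝ) 1 ×ℂ Icc (0 : ℝ) 1, q (p z) = x := by
  obtain ⟨e, rfl⟩ := h.surjective_right x
  obtain ⟨z, hz, rfl⟩ := h.exists_mem_rect e
  rw [Complex.mem_reProdIm, mem_Icc, mem_Icc] at hz
  rcases le_total z.re 1 with h1 | h1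
  · exact ⟨z, Complex.mem_reProdIm.2 ⟨⟨hz.1.1, h1⟩, hz.2⟩, rfl⟩
  -- The right half of the rectangle is brought back by the inverse glide and a translation.
  · refine ⟨(starRingEnd ℂ) z + (-1) + 2 * (0 : ℤ) + (1 : ℤ) * Complex.I, ?_, ?_⟩
    · rw [Complex.mem_reProdIm]
      simp
      constructor <;> constructor <;> linarith
    · rw [h.left_add]
      exact h.comp_conj_sub_one z

/-- Points of the unit square with the same image in `M` are identified by the sides of the square
that are glued to form the Klein bottle. -/
theorem eqvGen_kleinRel {a b : I × I} (hab : q (p ⟨a.1, a.2⟩) = q (p ⟨b.1, b.2⟩)) :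
    Relation.EqvGen KleinRel a b := by
  obtain ⟨⟨x, hx0, hx1⟩, ⟨y, hy0, hy1⟩⟩ := a
  obtain ⟨⟨x', hx0', hx1'⟩, ⟨y', hy0', hy1'⟩⟩ := b
  obtain ⟨⟨b, m, n⟩, hz⟩ := (h.right_eq_iff_exists _ _).1 hab
  have hre := congrArg Complex.re hz
  have him := congrArg Complex.im hz
  have glue (x : I) : Relation.EqvGen KleinRel (x, 0) (x, 1) := .rel _ _ (.glue x)
  have flip (y : I) : Relation.EqvGen KleinRel (0, y) (1, σ y) := .rel _ _ (.flip y)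
  cases b
  -- Translations identify points of the square only along the horizontal sides.
  · simp at hre him
    have hm : m = 0 := by
      have h1 : ((-1 : ℤ) : ℝ) < m := by push_cast; linarith
      have h2 : (m : ℝ) < ((1 : ℤ) : ℝ) := by push_cast; linarith
      have h1 := Int.cast_lt.1 h1
      have h2 := Int.cast_lt.1 h2
      lia
    subst hm
    obtain rfl : x' = x := by simpa using hre
    have h1 : ((-1 : ℤ) : ℝ) ≤ n := by push_cast; linarith
    have h2 : (n : ℝ) ≤ ((1 : ℤ) : ℝ) := by push_cast; linarith
    have h1 := Int.cast_le.1 h1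
    have h2 := Int.cast_le.1 h2
    have h3 : n = -1 ∨ n = 0 ∨ n = 1 := by lia
    rcases h3 with rfl | rfl | rfl
    · push_cast at him
      obtain rfl : y = 1 := by linarith
      obtain rfl : y' = 0 := by linarith
      exact (glue _).symm
    · obtain rfl : y' = y := by simpa using him
      exact .refl _
    · push_cast at him
      obtain rfl : y = 0 := by linarith
      obtain rfl : y' = 1 := by linarith
      exact glue _
  -- Glides identify points of the vertical sides, with ordinates `y'` and `-y + n`; the values
  -- `n = 0` and `n = 2` occur at the corners only, which are all equivalent.
  · simp [glide] at hre him
    have hcorner : Relation.EqvGen KleinRel (0, 0) (1, 0) := by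
      have := flip 0
      rw [unitInterval.symm_zero] at this
      exact this.trans _ _ _ (glue 1).symm
    have hcorner' : Relation.EqvGen KleinRel (0, 1) (1, 1) := by
      have := flip 1
      rw [unitInterval.symm_one] at this
      exact this.trans _ _ _ (glue 1)
    have hcross : ∀ (y y' : ℝ) (hy : y ∈ I) (hy' : y' ∈ I) (n : ℤ), y' = -y + n →
        Relation.EqvGen KleinRel (0, ⟨y, hy⟩) (1, ⟨y', hy'⟩) := by
      rintro y y' ⟨hy0, hy1⟩ ⟨hy0', hy1'⟩ n hn
      have h1 : ((0 : ℤ) : ℝ) ≤ n := by push_cast; linarith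
      have h2 : (n : ℝ) ≤ ((2 : ℤ) : ℝ) := by push_cast; linarith
      have h1 := Int.cast_le.1 h1
      have h2 := Int.cast_le.1 h2
      have h3 : n = 0 ∨ n = 1 ∨ n = 2 := by lia
      rcases h3 with rfl | rfl | rfl
      · push_cast at hn
        obtain rfl : y = 0 := by linarith
        obtain rfl : y' = 0 := by linarith
        exact hcorner
      · have : (⟨y', hy0', hy1'⟩ : I) = σ ⟨y, hy0, hy1⟩ := by
          apply Subtype.ext
          simp [hn]; ring
        rw [this]
        exact flip _
      · push_cast at hn
        obtain rfl : y = 1 := by linarith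
        obtain rfl : y' = 1 := by linarith
        exact hcorner'
    have hm : m = 0 ∨ m = -1 := by
      have h1 : ((-2 : ℤ) : ℝ) < m := by push_cast; linarith
      have h2 : (m : ℝ) < ((1 : ℤ) : ℝ) := by push_cast; linarith
      have h1 := Int.cast_lt.1 h1
      have h2 := Int.cast_lt.1 h2
      lia
    rcases hm with rfl | rfl
    · push_cast at hre
      obtain rfl : x = 0 := by linarith
      obtain rfl : x' = 1 := by linarith
      exact hcross y y' _ _ n him
    · push_cast at hre
      obtain rfl : x = 1 := by linarith
      obtain rfl : x' = 0 := by linarith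
      exact (hcross y' y _ _ n (by linarith)).symm

theorem comp_eq_of_kleinRel {a b : I × I} (hab : KleinRel a b) :
    q (p ⟨a.1, a.2⟩) = q (p ⟨b.1, b.2⟩) := by
  rw [h.right_eq_iff_exists]
  cases hab with
  | flip y => exact ⟨(true, 0, 1), by apply Complex.ext <;> simp [glide]; ring⟩
  | glue x => exact ⟨(false, 0, 1), by apply Complex.ext <;> simp⟩

theorem nonempty_homeomorph_kleinBottle [T2Space M] : Nonempty (M ≃ₜ KleinBottle) := by
  have hc : Continuous fun a : I × I => q (p ⟨a.1, a.2⟩) := by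
    refine h.continuous_right.comp (h.continuous_left.comp ?_)
    have : (fun a : I × I => (⟨a.1, a.2⟩ : ℂ)) =
        fun a : I × I => ((a.1 : ℝ) : ℂ) + ((a.2 : ℝ) : ℂ) * Complex.I :=
      funext fun a => Complex.mk_eq_add_mul_I _ _
    rw [this]
    fun_prop
  set F : KleinBottle → M := Quot.lift (fun a : I × I => q (p ⟨a.1, a.2⟩))
    fun a b hab => h.comp_eq_of_kleinRel hab with hF
  have hF' : Continuous F := continuous_quot_lift _ hc
  have hbij : Function.Bijective F := by
    constructor
    · rintro ⟨a⟩ ⟨b⟩ hab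
      exact Quot.eqvGen_sound (h.eqvGen_kleinRel hab)
    · intro x
      obtain ⟨z, hz, rfl⟩ := h.exists_mem_square x
      exact ⟨Quot.mk _ (⟨z.re, hz.1⟩, ⟨z.im, hz.2⟩), rfl⟩
  exact ⟨(Continuous.homeoOfEquivCompactToT2 (f := Equiv.ofBijective F hbij) hF').symm⟩

end IsGlideModel

/-! ### Null frames and crooked planes -/

/-- A frame of Minkowski space made of two null vectors and of a unit spacelike vector orthogonal
to both, in which the quadratic form is `c² - a b`. -/
structure NullFrame (v₁ v₂ v₃ : Mink) : Prop where
  h11 : lorentz v₁ v₁ = 0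
  h22 : lorentz v₂ v₂ = 0
  h12 : lorentz v₁ v₂ = -1 / 2
  h13 : lorentz v₁ v₃ = 0
  h23 : lorentz v₂ v₃ = 0
  h33 : lorentz v₃ v₃ = 1

/-- The vector with coordinates `(a, b, c)` in the frame `(v₁, v₂, v₃)`. -/
def comb (v₁ v₂ v₃ : Mink) (a b c : ℝ) : Mink := a • v₁ + b • v₂ + c • v₃

theorem lorentz_comm (u v : Mink) : lorentz u v = lorentz v u := by
  simp only [lorentz]; ring

theorem lorentz_comb_left (v₁ v₂ v₃ : Mink) (a b c : ℝ) (u : Mink) :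
    lorentz (comb v₁ v₂ v₃ a b c) u =
      a * lorentz v₁ u + b * lorentz v₂ u + c * lorentz v₃ u := by
  simp only [lorentz, comb, Pi.add_apply, Pi.smul_apply, smul_eq_mul]; ring

theorem lorentz_comb_right (v₁ v₂ v₃ : Mink) (a b c : ℝ) (u : Mink) :
    lorentz u (comb v₁ v₂ v₃ a b c) =
      a * lorentz u v₁ + b * lorentz u v₂ + c * lorentz u v₃ := by
  simp only [lorentz, comb, Pi.add_apply, Pi.smul_apply, smul_eq_mul]; ring

theorem comb_smul (v₁ v₂ v₃ : Mink) (r a b c : ℝ) :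
    comb v₁ v₂ v₃ (r * a) (r * b) (r * c) = r • comb v₁ v₂ v₃ a b c := by
  simp only [comb, smul_add, smul_smul]

/-- The determinant of three vectors of Minkowski space. -/
def det3 (u v w : Mink) : ℝ := Matrix.det (Matrix.of ![u, v, w])

theorem det3_eq (u v w : Mink) : det3 u v w =
    u 0 * v 1 * w 2 - u 0 * v 2 * w 1 - u 1 * v 0 * w 2 + u 1 * v 2 * w 0
      + u 2 * v 0 * w 1 - u 2 * v 1 * w 0 := by
  simp [det3, Matrix.det_fin_three]

theorem det3_comb_fst (v₁ v₂ v₃ : Mink) (α β γ a c : ℝ) :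
    det3 (comb v₁ v₂ v₃ α β γ) v₁ (comb v₁ v₂ v₃ a 0 c) = -(β * c * det3 v₁ v₂ v₃) := by
  simp only [det3_eq, comb, Pi.add_apply, Pi.smul_apply, smul_eq_mul]; ring

theorem det3_comb_snd (v₁ v₂ v₃ : Mink) (α β γ b c : ℝ) :
    det3 (comb v₁ v₂ v₃ α β γ) v₂ (comb v₁ v₂ v₃ 0 b c) = α * c * det3 v₁ v₂ v₃ := by
  simp only [det3_eq, comb, Pi.add_apply, Pi.smul_apply, smul_eq_mul]; ring

/-- The wing of the lightlike geodesic `p + ℝ v` of the sign of the nonzero real number `s`. -/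
def wing (s : ℝ) (p v : Mink) : Set Mink :=
  {q | q ∈ nullPlane p v ∧
    ∃ u : Mink, lorentz u u < 0 ∧ lorentz u v < 0 ∧ 0 < s * det3 u v (q - p)}

theorem posWing_eq (p v : Mink) : posWing p v = wing 1 p v := by
  simp only [posWing, wing, one_mul, det3]

theorem negWing_eq (p v : Mink) : negWing p v = wing (-1) p v := by
  simp only [negWing, wing, neg_one_mul, neg_pos, det3]

namespace NullFrame

variable {v₁ v₂ v₃ : Mink} (h : NullFrame v₁ v₂ v₃)
include h

theorem lorentz_comb (a b c a' b' c' : ℝ) :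
    lorentz (comb v₁ v₂ v₃ a b c) (comb v₁ v₂ v₃ a' b' c') =
      c * c' - (a * b' + b * a') / 2 := by
  rw [lorentz_comb_left, lorentz_comb_right, lorentz_comb_right, lorentz_comb_right, h.h11, h.h12,
    h.h13, h.h22, h.h23, h.h33, lorentz_comm v₂ v₁, lorentz_comm v₃ v₁, lorentz_comm v₃ v₂, h.h12,
    h.h13, h.h23]
  ring

theorem lorentz_comb_fst (a b c : ℝ) : lorentz (comb v₁ v₂ v₃ a b c) v₁ = -b / 2 := by
  rw [lorentz_comb_left, h.h11, lorentz_comm v₂, lorentz_comm v₃, h.h12, h.h13]; ring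

theorem lorentz_comb_snd (a b c : ℝ) : lorentz (comb v₁ v₂ v₃ a b c) v₂ = -a / 2 := by
  rw [lorentz_comb_left, h.h22, lorentz_comm v₃, h.h12, h.h23]; ring

theorem lorentz_comb_trd (a b c : ℝ) : lorentz (comb v₁ v₂ v₃ a b c) v₃ = c := by
  rw [lorentz_comb_left, h.h13, h.h23, h.h33]; ring

theorem comb_inj {a b c a' b' c' : ℝ}
    (he : comb v₁ v₂ v₃ a b c = comb v₁ v₂ v₃ a' b' c') : a = a' ∧ b = b' ∧ c = c' := by
  have h1 := h.lorentz_comb_fst a b c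
  have h2 := h.lorentz_comb_snd a b c
  have h3 := h.lorentz_comb_trd a b c
  rw [he] at h1 h2 h3
  rw [h.lorentz_comb_fst] at h1
  rw [h.lorentz_comb_snd] at h2
  rw [h.lorentz_comb_trd] at h3
  exact ⟨by linarith, by linarith, h3.symm⟩

theorem exists_comb (w : Mink) : ∃ a b c, w = comb v₁ v₂ v₃ a b c := by
  let L : (Fin 3 → ℝ) →ₗ[ℝ] (Fin 3 → ℝ) :=
    { toFun := fun y => comb v₁ v₂ v₃ (y 0) (y 1) (y 2)
      map_add' := fun x y => by simp only [comb, Pi.add_apply]; module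
      map_smul' := fun r x => comb_smul _ _ _ _ _ _ _ }
  have hinj : Function.Injective L := fun x y hxy => by
    obtain ⟨h0, h1, h2⟩ := h.comb_inj hxy
    ext i
    fin_cases i <;> assumption
  obtain ⟨y, hy⟩ := LinearMap.injective_iff_surjective.1 hinj w
  exact ⟨y 0, y 1, y 2, hy.symm⟩

theorem mem_wing_fst_iff (s : ℝ) (p : Mink) (a b c : ℝ) :
    p + comb v₁ v₂ v₃ a b c ∈ wing s p v₁ ↔ b = 0 ∧ s * (c * det3 v₁ v₂ v₃) < 0 := by
  simp only [wing, nullPlane, mem_ofPred_eq, add_sub_cancel_left, h.lorentz_comb_fst]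
  have hb : -b / 2 = 0 ↔ b = 0 := by constructor <;> intro hb <;> linarith
  rw [hb]
  refine and_congr_right ?_
  rintro rfl
  constructor
  · rintro ⟨u, -, huv, hd⟩
    obtain ⟨α, β, γ, rfl⟩ := h.exists_comb u
    rw [h.lorentz_comb_fst] at huv
    rw [det3_comb_fst] at hd
    have hβ : 0 < β := by linarith
    by_contra hcon
    push Not at hcon
    nlinarith [mul_nonneg hβ.le hcon]
  · intro hs
    refine ⟨comb v₁ v₂ v₃ 1 1 0, ?_, ?_, ?_⟩
    · rw [h.lorentz_comb]; norm_num
    · rw [h.lorentz_comb_fst]; norm_num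
    · rw [det3_comb_fst]; linarith

theorem mem_wing_snd_iff (s : ℝ) (p : Mink) (a b c : ℝ) :
    p + comb v₁ v₂ v₃ a b c ∈ wing s p v₂ ↔ a = 0 ∧ 0 < s * (c * det3 v₁ v₂ v₃) := by
  simp only [wing, nullPlane, mem_ofPred_eq, add_sub_cancel_left, h.lorentz_comb_snd]
  have ha : -a / 2 = 0 ↔ a = 0 := by constructor <;> intro ha <;> linarith
  rw [ha]
  refine and_congr_right ?_
  rintro rfl
  constructor
  · rintro ⟨u, -, huv, hd⟩
    obtain ⟨α, β, γ, rfl⟩ := h.exists_comb u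
    rw [h.lorentz_comb_snd] at huv
    rw [det3_comb_snd] at hd
    have hα : 0 < α := by linarith
    by_contra hcon
    push Not at hcon
    nlinarith [mul_nonneg hα.le (neg_nonneg.2 hcon)]
  · intro hs
    refine ⟨comb v₁ v₂ v₃ 1 1 0, ?_, ?_, ?_⟩
    · rw [h.lorentz_comb]; norm_num
    · rw [h.lorentz_comb_snd]; norm_num
    · rw [det3_comb_snd]; linarith

theorem mem_stem_iff (p : Mink) (a b c : ℝ) :
    p + comb v₁ v₂ v₃ a b c ∈ stem p v₁ v₂ ↔ c = 0 ∧ 0 ≤ a * b := by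
  set q := p + comb v₁ v₂ v₃ a b c with hq
  have he : q - p = comb v₁ v₂ v₃ a b c := by simp [hq]
  have hspan : q - p ∈ Submodule.span ℝ {v₁, v₂} ↔ c = 0 := by
    rw [Submodule.mem_span_pair, he]
    constructor
    · rintro ⟨x, y, hxy⟩
      have : comb v₁ v₂ v₃ x y 0 = comb v₁ v₂ v₃ a b c := by rw [← hxy]; simp [comb]
      exact (h.comb_inj this).2.2.symm
    · rintro rfl
      exact ⟨a, b, by simp [comb]⟩
  have hcaus : q ∈ causalFuture p ∪ causalPast p ↔ lorentz (q - p) (q - p) ≤ 0 := by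
    constructor
    · rintro (h | h) <;> exact h.1
    · intro hl
      rcases le_total 0 ((q - p) 2) with h2 | h2
      · exact .inl ⟨hl, h2⟩
      · exact .inr ⟨hl, h2⟩
  change _ ∧ q - p ∈ Submodule.span ℝ {v₁, v₂} ↔ _
  rw [hspan, hcaus, he, h.lorentz_comb, and_comm]
  refine and_congr_right ?_
  rintro rfl
  constructor <;> intro h <;> linarith

end NullFrame

/-- The condition on the coordinates of `q - p` in a null frame, for a point `q` of a crooked plane
with vertex `p`: the alternatives are the stem and the two wings. -/
def CrookedCond (a b c : ℝ) : Prop := (c = 0 ∧ 0 ≤ a * b) ∨ (b = 0 ∧ 0 < c) ∨ (a = 0 ∧ c < 0)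

theorem wing_smul (s : ℝ) (p v : Mink) {t : ℝ} (ht : t ≠ 0) : wing s p (t • v) = wing s p v := by
  have key : ∀ (v : Mink) (t : ℝ), t ≠ 0 → wing s p v ⊆ wing s p (t • v) := by
    rintro v t ht q ⟨hq, u, hu, huv, hd⟩
    have hq : lorentz (q - p) v = 0 := hq
    refine ⟨?_, t • u, ?_, ?_, ?_⟩
    · change lorentz (q - p) (t • v) = 0
      have : lorentz (q - p) (t • v) = t * lorentz (q - p) v := by
        simp only [lorentz, Pi.smul_apply, smul_eq_mul]; ring
      rw [this, hq, mul_zero]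
    · have : lorentz (t • u) (t • u) = t ^ 2 * lorentz u u := by
        simp only [lorentz, Pi.smul_apply, smul_eq_mul]; ring
      rw [this]
      exact mul_neg_of_pos_of_neg (by positivity) hu
    · have : lorentz (t • u) (t • v) = t ^ 2 * lorentz u v := by
        simp only [lorentz, Pi.smul_apply, smul_eq_mul]; ring
      rw [this]
      exact mul_neg_of_pos_of_neg (by positivity) huv
    · have : s * det3 (t • u) (t • v) (q - p) = t ^ 2 * (s * det3 u v (q - p)) := by
        simp only [det3_eq, Pi.smul_apply, smul_eq_mul]; ring
      rw [this]
      positivity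
  refine Subset.antisymm ?_ (key v t ht)
  have := key (t • v) t⁻¹ (inv_ne_zero ht)
  rwa [inv_smul_smul₀ ht] at this

theorem stem_smul (p v₁ v₂ : Mink) {t : ℝ} (ht : t ≠ 0) : stem p v₁ (t • v₂) = stem p v₁ v₂ := by
  unfold stem
  rw [Submodule.span_insert, Submodule.span_insert, Submodule.span_singleton_smul_eq
    (IsUnit.mk0 t ht)]

/-- Two orthogonal null vectors of `ℝ²·¹` are proportional. -/
theorem lorentz_ne_zero {v₁ v₂ : Mink} (h1 : lorentz v₁ v₁ = 0) (h2 : lorentz v₂ v₂ = 0)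
    (hli : LinearIndependent ℝ ![v₁, v₂]) : lorentz v₁ v₂ ≠ 0 := by
  intro h12
  simp only [lorentz] at h1 h2 h12
  -- The vector `v₂ 2 • v₁ - v₁ 2 • v₂` is null with vanishing time coordinate, hence zero.
  have hsq : (v₂ 2 * v₁ 0 - v₁ 2 * v₂ 0) ^ 2 + (v₂ 2 * v₁ 1 - v₁ 2 * v₂ 1) ^ 2 = 0 := by
    linear_combination (v₂ 2) ^ 2 * h1 + (v₁ 2) ^ 2 * h2 - 2 * v₁ 2 * v₂ 2 * h12
  have hx : v₂ 2 * v₁ 0 - v₁ 2 * v₂ 0 = 0 := by nlinarith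
  have hy : v₂ 2 * v₁ 1 - v₁ 2 * v₂ 1 = 0 := by nlinarith
  have h0 : v₂ 2 • v₁ + (-v₁ 2) • v₂ = 0 := by
    ext i
    fin_cases i
    · simp; linarith
    · simp; linarith
    · simp; ring
  have hz := LinearIndependent.pair_iff.1 hli _ _ h0
  have hz1 : v₁ 2 = 0 := by linarith [hz.2]
  have hv : v₁ = 0 := by
    rw [hz1] at h1
    ext i
    fin_cases i
    · change v₁ 0 = 0; nlinarith
    · change v₁ 1 = 0; nlinarith
    · exact hz1
  exact hli.ne_zero 0 hv

/-- Two null vectors with product `-1/2` are completed to a null frame by twice their Lorentzian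
cross product, with either sign; this sign is the orientation of the frame. -/
theorem exists_nullFrame {v₁ v₂ : Mink} (h1 : lorentz v₁ v₁ = 0) (h2 : lorentz v₂ v₂ = 0)
    (h12 : lorentz v₁ v₂ = -1 / 2) {s : ℝ} (hs : s ^ 2 = 1) :
    ∃ v₃, NullFrame v₁ v₂ v₃ ∧ det3 v₁ v₂ v₃ = s / 2 := by
  -- The identity `⟨n, n⟩ = ⟨v₁, v₂⟩² - ⟨v₁, v₁⟩ ⟨v₂, v₂⟩` for the cross product `n` is used.
  refine ⟨![2 * s * (v₁ 1 * v₂ 2 - v₁ 2 * v₂ 1), 2 * s * (v₁ 2 * v₂ 0 - v₁ 0 * v₂ 2),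
    -(2 * s * (v₁ 0 * v₂ 1 - v₁ 1 * v₂ 0))], ⟨h1, h2, h12, ?_, ?_, ?_⟩, ?_⟩
  · simp [lorentz]; ring
  · simp [lorentz]; ring
  · simp only [lorentz] at *
    simp
    linear_combination 4 * s ^ 2 * (v₁ 0 * v₂ 0 + v₁ 1 * v₂ 1 - v₁ 2 * v₂ 2 - 1 / 2) * h12 + hs
      - 4 * s ^ 2 * (v₂ 0 * v₂ 0 + v₂ 1 * v₂ 1 - v₂ 2 * v₂ 2) * h1
  · rw [det3_eq]
    simp only [lorentz] at *
    simp
    linear_combination 2 * s * (v₁ 0 * v₂ 0 + v₁ 1 * v₂ 1 - v₁ 2 * v₂ 2 - 1 / 2) * h12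
      - 2 * s * (v₂ 0 * v₂ 0 + v₂ 1 * v₂ 1 - v₂ 2 * v₂ 2) * h1

/-- Every crooked plane is described by `CrookedCond` in the coordinates of a suitable null frame
at its vertex. The orientation of the frame absorbs the sign of the wings. -/
theorem IsCrookedPlane.exists_nullFrame {C : Set Mink} (hC : IsCrookedPlane C) :
    ∃ p v₁ v₂ v₃, NullFrame v₁ v₂ v₃ ∧
      ∀ a b c, p + comb v₁ v₂ v₃ a b c ∈ C ↔ CrookedCond a b c := by
  obtain ⟨p, v₁, v₂, h1, h2, hli, hC⟩ := hC
  have hk := lorentz_ne_zero h1 h2 hli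
  obtain ⟨t, ht, h22', h12'⟩ : ∃ t : ℝ, t ≠ 0 ∧ lorentz (t • v₂) (t • v₂) = 0 ∧
      lorentz v₁ (t • v₂) = -1 / 2 := by
    refine ⟨-1 / 2 / lorentz v₁ v₂, by simp [hk], ?_, ?_⟩
    · have : ∀ t : ℝ, lorentz (t • v₂) (t • v₂) = t ^ 2 * lorentz v₂ v₂ := fun t => by
        simp only [lorentz, Pi.smul_apply, smul_eq_mul]; ring
      rw [this, h2, mul_zero]
    · have : ∀ t : ℝ, lorentz v₁ (t • v₂) = t * lorentz v₁ v₂ := fun t => by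
        simp only [lorentz, Pi.smul_apply, smul_eq_mul]; ring
      rw [this, div_mul_cancel₀ _ hk]
  obtain ⟨s, hs, hC⟩ : ∃ s : ℝ, s ^ 2 = 1 ∧
      C = wing s p v₁ ∪ stem p v₁ v₂ ∪ wing s p v₂ := by
    rw [posWing_eq, posWing_eq, negWing_eq, negWing_eq] at hC
    rcases hC with hC | hC
    · exact ⟨1, by norm_num, hC⟩
    · exact ⟨-1, by norm_num, hC⟩
  rw [← wing_smul s p v₂ ht, ← stem_smul p v₁ v₂ ht] at hC
  obtain ⟨v₃, hF, hd⟩ := Crooked.exists_nullFrame h1 h22' h12' (s := -s) (by rw [neg_sq, hs])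
  refine ⟨p, v₁, t • v₂, v₃, hF, fun a b c => ?_⟩
  -- The frame has the orientation opposite to the sign of the wings, so that `c > 0` on the first.
  have hsc : s * (c * (-s / 2)) = -c / 2 := by linear_combination -(c / 2) * hs
  rw [hC, mem_union, mem_union, hF.mem_wing_fst_iff, hF.mem_wing_snd_iff, hF.mem_stem_iff, hd,
    hsc, CrookedCond, or_comm (a := b = 0 ∧ _), or_assoc]
  refine or_congr_right (or_congr (and_congr_right fun _ => ?_) (and_congr_right fun _ => ?_))
  · constructor <;> intro h <;> linarith
  · constructor <;> intro h <;> linarith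

/-! ### A parametrization of the lifted surface by the torus -/

/-- The odd function of `k` that is `sign A * k` for `|k| ≤ |A|`, and is constant on either side
of this interval. -/
noncomputable def clampCoord (A k : ℝ) : ℝ := (|A + k| - |A - k|) / 2

/-- Half the square root of `k² - A²`, with the sign of `P k`; it vanishes for `|k| ≤ |A|` because
`Real.sqrt` vanishes on negative numbers. -/
noncomputable def wingCoord (A P k : ℝ) : ℝ :=
  if 0 ≤ P * k then √(k ^ 2 - A ^ 2) / 2 else -(√(k ^ 2 - A ^ 2) / 2)

/-- The parametrization `(a, b, c, U, V)` of the null vectors of `c² = a b + U V` that lie over the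
closure of a crooked plane, in terms of `A = a + b`, `P = U + V`, `Q = V - U` and of a parameter
`k` subject to `A² + P² = k² + Q²`. The stem is `|k| ≤ |A|`, the two wings are `k ≥ |A|` and
`k ≤ -|A|`. -/
noncomputable def surfaceCoord (A P k Q : ℝ) : Fin 5 → ℝ :=
  ![(A + clampCoord A k) / 2, (A - clampCoord A k) / 2, wingCoord A P k, (P - Q) / 2, (P + Q) / 2]

theorem clampCoord_of_abs_le {A k : ℝ} (h : |k| ≤ A) : clampCoord A k = k := by
  rw [abs_le] at h
  rw [clampCoord, abs_of_nonneg (by linarith), abs_of_nonneg (by linarith)]; ring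

theorem clampCoord_neg_left (A k : ℝ) : clampCoord (-A) k = -clampCoord A k := by
  rw [clampCoord, clampCoord, ← abs_neg (-A + k), ← abs_neg (-A - k)]
  ring_nf

theorem clampCoord_comm (A k : ℝ) : clampCoord A k = clampCoord k A := by
  rw [clampCoord, clampCoord, add_comm, abs_sub_comm]

theorem clampCoord_neg_right (A k : ℝ) : clampCoord A (-k) = -clampCoord A k := by
  rw [clampCoord_comm, clampCoord_neg_left, clampCoord_comm]

theorem clampCoord_of_abs_le_neg {A k : ℝ} (h : |k| ≤ -A) : clampCoord A k = -k := by
  rw [← neg_neg A, clampCoord_neg_left, clampCoord_of_abs_le h]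

theorem clampCoord_smul {r : ℝ} (hr : 0 ≤ r) (A k : ℝ) :
    clampCoord (r * A) (r * k) = r * clampCoord A k := by
  rw [clampCoord, clampCoord, ← mul_add, ← mul_sub, abs_mul, abs_mul, abs_of_nonneg hr]; ring

theorem wingCoord_of_abs_le {A k : ℝ} (P : ℝ) (h : |k| ≤ |A|) : wingCoord A P k = 0 := by
  have : √(k ^ 2 - A ^ 2) = 0 := Real.sqrt_eq_zero_of_nonpos (by linarith [sq_le_sq.2 h])
  simp [wingCoord, this]

theorem wingCoord_smul {r : ℝ} (hr : 0 < r) (A P k : ℝ) :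
    wingCoord (r * A) (r * P) (r * k) = r * wingCoord A P k := by
  have h1 : √((r * k) ^ 2 - (r * A) ^ 2) = r * √(k ^ 2 - A ^ 2) := by
    rw [show (r * k) ^ 2 - (r * A) ^ 2 = r ^ 2 * (k ^ 2 - A ^ 2) by ring,
      Real.sqrt_mul (by positivity), Real.sqrt_sq hr.le]
  have h2 : 0 ≤ r * P * (r * k) ↔ 0 ≤ P * k := by
    rw [show r * P * (r * k) = r ^ 2 * (P * k) by ring]
    exact mul_nonneg_iff_of_pos_left (by positivity)
  simp only [wingCoord, h1, h2]
  split_ifs <;> ring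

/-- The parametrization is homogeneous, which allows its parameters to be normalized. -/
theorem surfaceCoord_smul {r : ℝ} (hr : 0 < r) (A P k Q : ℝ) :
    surfaceCoord (r * A) (r * P) (r * k) (r * Q) = r • surfaceCoord A P k Q := by
  rw [surfaceCoord, clampCoord_smul hr.le, wingCoord_smul hr]
  ext i
  fin_cases i <;> simp [surfaceCoord] <;> ring

theorem sqrt_sub_sq_eq_zero_of_mul_eq_zero {A P k Q : ℝ} (h : A ^ 2 + P ^ 2 = k ^ 2 + Q ^ 2)
    (hPk : P * k = 0) : √(k ^ 2 - A ^ 2) = 0 := by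
  apply Real.sqrt_eq_zero_of_nonpos
  rcases mul_eq_zero.1 hPk with rfl | rfl
  · nlinarith
  · nlinarith

theorem wingCoord_neg_left {A P k Q : ℝ} (h : A ^ 2 + P ^ 2 = k ^ 2 + Q ^ 2) :
    wingCoord (-A) (-P) k = -wingCoord A P k := by
  rcases lt_trichotomy (P * k) 0 with hPk | hPk | hPk
  · rw [wingCoord, wingCoord, if_pos (by linarith), if_neg (by linarith)]; simp
  · simp [wingCoord, sqrt_sub_sq_eq_zero_of_mul_eq_zero h hPk]
  · rw [wingCoord, wingCoord, if_neg (by linarith), if_pos (by linarith)]; simp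

/-- The antipodal map in the parameters: it is a glide reflection of the torus. -/
theorem surfaceCoord_neg {A P k Q : ℝ} (h : A ^ 2 + P ^ 2 = k ^ 2 + Q ^ 2) :
    surfaceCoord (-A) (-P) k (-Q) = -surfaceCoord A P k Q := by
  rw [surfaceCoord, clampCoord_neg_left, wingCoord_neg_left h]
  ext i
  fin_cases i <;> simp [surfaceCoord] <;> ring

theorem four_mul_wingCoord_sq (A P k : ℝ) : 4 * wingCoord A P k ^ 2 = max 0 (k ^ 2 - A ^ 2) := by
  have : (√(k ^ 2 - A ^ 2)) ^ 2 = max 0 (k ^ 2 - A ^ 2) := by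
    rcases le_total 0 (k ^ 2 - A ^ 2) with h | h
    · rw [Real.sq_sqrt h, max_eq_right h]
    · rw [Real.sqrt_eq_zero_of_nonpos h, max_eq_left h]; simp
  rw [← this, wingCoord]
  split_ifs <;> ring

theorem clampCoord_sq (A k : ℝ) : clampCoord A k ^ 2 = min (A ^ 2) (k ^ 2) := by
  have key : ∀ A k : ℝ, |k| ≤ |A| → clampCoord A k ^ 2 = k ^ 2 := by
    intro A k h
    rcases le_total 0 A with hA | hA
    · rw [clampCoord_of_abs_le (by rwa [abs_of_nonneg hA] at h)]
    · rw [clampCoord_of_abs_le_neg (by rwa [abs_of_nonpos hA] at h), neg_sq]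
  rcases le_total |k| |A| with h | h
  · rw [key A k h, min_eq_right (sq_le_sq.2 h)]
  · rw [clampCoord_comm, key k A h, min_eq_left (sq_le_sq.2 h)]

theorem surfaceCoord_null {A P k Q : ℝ} (h : A ^ 2 + P ^ 2 = k ^ 2 + Q ^ 2) :
    surfaceCoord A P k Q 2 ^ 2 =
      surfaceCoord A P k Q 0 * surfaceCoord A P k Q 1 +
        surfaceCoord A P k Q 3 * surfaceCoord A P k Q 4 := by
  simp only [surfaceCoord, Matrix.cons_val]
  have h1 := four_mul_wingCoord_sq A P k
  have h2 := clampCoord_sq A k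
  rcases le_total (k ^ 2) (A ^ 2) with hk | hk
  · rw [max_eq_left (by linarith)] at h1
    rw [min_eq_right hk] at h2
    linear_combination h1 / 4 + h2 / 4 - h / 4
  · rw [max_eq_right (by linarith)] at h1
    rw [min_eq_left hk] at h2
    linear_combination h1 / 4 + h2 / 4 - h / 4

/-- Given the coordinates, `k` is known up to sign, and its sign is that of `A (a - b)` or, when
`A = 0`, that of `P c`. -/
theorem surfaceCoord_inj {A P k Q A' P' k' Q' : ℝ} (h1 : A ^ 2 + P ^ 2 = 1)
    (h2 : k ^ 2 + Q ^ 2 = 1) (h2' : k' ^ 2 + Q' ^ 2 = 1)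
    (he : surfaceCoord A P k Q = surfaceCoord A' P' k' Q') :
    A = A' ∧ P = P' ∧ k = k' ∧ Q = Q' := by
  have e0 := congrFun he 0
  have e1 := congrFun he 1
  have e2 := congrFun he 2
  have e3 := congrFun he 3
  have e4 := congrFun he 4
  simp only [surfaceCoord, Matrix.cons_val] at e0 e1 e2 e3 e4
  obtain rfl : A = A' := by linarith
  obtain rfl : P = P' := by linarith
  obtain rfl : Q = Q' := by linarith
  have hD : clampCoord A k = clampCoord A k' := by linarith
  refine ⟨rfl, rfl, ?_, rfl⟩
  rcases sq_eq_sq_iff_eq_or_eq_neg.1 (show k ^ 2 = k' ^ 2 by linarith) with hk | hk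
  · exact hk
  · obtain rfl : k' = -k := by linarith
    by_contra hne
    have hk0 : k ≠ 0 := fun h0 => hne (by rw [h0, neg_zero])
    rw [clampCoord_neg_right] at hD
    have hsq := clampCoord_sq A k
    have hA : A = 0 := by
      rw [show clampCoord A k = 0 by linarith] at hsq
      by_contra hA
      have : 0 < min (A ^ 2) (k ^ 2) := lt_min (by positivity) (by positivity)
      rw [← hsq] at this
      norm_num at this
    subst hA
    have hP : P ≠ 0 := by rintro rfl; norm_num at h1
    have hr : 0 < √(k ^ 2 - 0 ^ 2) := Real.sqrt_pos.2 (by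
      have : 0 < k ^ 2 := by positivity
      linarith)
    rcases lt_or_gt_of_ne (mul_ne_zero hP hk0) with hPk | hPk
    · rw [wingCoord, wingCoord, if_neg (by linarith), if_pos (by linarith), neg_sq] at e2
      generalize √(k ^ 2 - 0 ^ 2) = r at *
      linarith
    · rw [wingCoord, wingCoord, if_pos hPk.le, if_neg (by linarith), neg_sq] at e2
      generalize √(k ^ 2 - 0 ^ 2) = r at *
      linarith

/-- The two expressions of `wingCoord` agree where `P k = 0`, under the relation between the
parameters. -/
theorem continuousOn_wingCoord :
    ContinuousOn (fun x : ℝ × ℝ × ℝ × ℝ => wingCoord x.1 x.2.1 x.2.2.1)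
      {x | x.1 ^ 2 + x.2.1 ^ 2 = x.2.2.1 ^ 2 + x.2.2.2 ^ 2} := by
  rw [continuousOn_iff_continuous_domRestrict]
  refine Continuous.if_le (by fun_prop) (by fun_prop) (by fun_prop) (by fun_prop) ?_
  rintro ⟨x, hx⟩ h0
  have := sqrt_sub_sq_eq_zero_of_mul_eq_zero hx h0.symm
  simp only at this ⊢
  rw [this]
  simp

/-- The points of the parametrized surface that lie in Minkowski space satisfy the equations of the
crooked plane. -/
theorem crookedCond_surfaceCoord {A P k Q : ℝ} (h : A ^ 2 + P ^ 2 = k ^ 2 + Q ^ 2)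
    (hV : surfaceCoord A P k Q 4 ≠ 0) :
    CrookedCond (surfaceCoord A P k Q 0 / surfaceCoord A P k Q 4)
      (surfaceCoord A P k Q 1 / surfaceCoord A P k Q 4)
      (surfaceCoord A P k Q 2 / surfaceCoord A P k Q 4) := by
  simp only [surfaceCoord, Matrix.cons_val] at hV ⊢
  have hPQ : P + Q ≠ 0 := fun h0 => hV (by rw [h0, zero_div])
  rcases le_or_gt |k| |A| with hk | hk
  · refine .inl ⟨by rw [wingCoord_of_abs_le P hk, zero_div], ?_⟩
    rw [div_mul_div_comm]
    refine div_nonneg ?_ (mul_self_nonneg _)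
    have h1 := clampCoord_sq A k
    rw [min_eq_right (sq_le_sq.2 hk)] at h1
    nlinarith [sq_le_sq.2 hk]
  · have hlt : A ^ 2 < k ^ 2 := sq_lt_sq.2 hk
    have hQP : |Q| < |P| := sq_lt_sq.1 (by linarith)
    have hr : 0 < √(k ^ 2 - A ^ 2) := Real.sqrt_pos.2 (by linarith)
    rcases le_total 0 k with hk0 | hk0
    · rw [abs_of_nonneg hk0] at hk
      have hk1 : 0 < k := (abs_nonneg A).trans_lt hk
      refine .inr (.inl ⟨by rw [clampCoord_comm, clampCoord_of_abs_le hk.le]; simp, ?_⟩)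
      rcases le_or_gt 0 P with hP | hP
      · rw [abs_of_nonneg hP, abs_lt] at hQP
        rw [wingCoord, if_pos (by positivity)]
        exact div_pos (by positivity) (by linarith)
      · rw [abs_of_neg hP, abs_lt] at hQP
        rw [wingCoord, if_neg (by nlinarith)]
        exact div_pos_of_neg_of_neg (by linarith) (by linarith)
    · rw [abs_of_nonpos hk0] at hk
      have hk1 : k < 0 := by linarith [(abs_nonneg A).trans_lt hk]
      refine .inr (.inr ⟨by rw [clampCoord_comm, clampCoord_of_abs_le_neg hk.le]; simp, ?_⟩)
      rcases lt_or_ge 0 P with hP | hP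
      · rw [abs_of_pos hP, abs_lt] at hQP
        rw [wingCoord, if_neg (by nlinarith)]
        exact div_neg_of_neg_of_pos (by linarith) (by linarith)
      · rw [abs_of_nonpos hP, abs_lt] at hQP
        rw [wingCoord, if_pos (by nlinarith)]
        exact div_neg_of_pos_of_neg (by positivity) (by linarith)

/-- Every point of the crooked plane is parametrized. On the stem `k` is `a - b` up to the sign of
`a + b`; on the wings it is a square root. -/
theorem exists_surfaceCoord_eq {a b c : ℝ} (h : CrookedCond a b c) :
    ∃ A P k Q : ℝ, A ^ 2 + P ^ 2 = k ^ 2 + Q ^ 2 ∧ 0 < A ^ 2 + P ^ 2 ∧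
      surfaceCoord A P k Q = ![a, b, c, c ^ 2 - a * b, 1] := by
  -- `A = P = 0` would force `c² + a² + 1 = 0`.
  have hpos : 0 < (a + b) ^ 2 + (c ^ 2 - a * b + 1) ^ 2 := by
    by_contra hcon
    push Not at hcon
    have h1 : a + b = 0 := by nlinarith [sq_nonneg (c ^ 2 - a * b + 1), sq_nonneg (a + b)]
    have h2 : c ^ 2 - a * b + 1 = 0 := by
      nlinarith [sq_nonneg (c ^ 2 - a * b + 1), sq_nonneg (a + b)]
    obtain rfl : b = -a := by linarith
    nlinarith [sq_nonneg a, sq_nonneg c]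
  have key : ∀ k : ℝ, k ^ 2 = (a - b) ^ 2 + 4 * c ^ 2 → clampCoord (a + b) k = a - b →
      wingCoord (a + b) (c ^ 2 - a * b + 1) k = c →
      ∃ A P k Q : ℝ, A ^ 2 + P ^ 2 = k ^ 2 + Q ^ 2 ∧ 0 < A ^ 2 + P ^ 2 ∧
        surfaceCoord A P k Q = ![a, b, c, c ^ 2 - a * b, 1] := by
    intro k hk hD hc
    refine ⟨a + b, c ^ 2 - a * b + 1, k, 1 - (c ^ 2 - a * b), by rw [hk]; ring, hpos, ?_⟩
    rw [surfaceCoord, hD, hc]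
    ext i
    fin_cases i <;> simp <;> ring
  rcases h with ⟨rfl, hab⟩ | ⟨rfl, hc⟩ | ⟨rfl, hc⟩
  · have habs : |a - b| ≤ |a + b| := sq_le_sq.1 (by nlinarith)
    rcases le_total 0 (a + b) with h0 | h0
    · exact key (a - b) (by ring)
        (clampCoord_of_abs_le (by rwa [abs_of_nonneg h0] at habs)) (wingCoord_of_abs_le _ habs)
    · have habs' : |-(a - b)| ≤ |a + b| := by rwa [abs_neg]
      refine key (-(a - b)) (by ring) ?_ (wingCoord_of_abs_le _ habs')
      rw [clampCoord_of_abs_le_neg (by rwa [abs_of_nonpos h0] at habs'), neg_neg]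
  · have hs : √(a ^ 2 + 4 * c ^ 2) ^ 2 = a ^ 2 + 4 * c ^ 2 := Real.sq_sqrt (by positivity)
    have habs : |a| ≤ √(a ^ 2 + 4 * c ^ 2) := Real.abs_le_sqrt (by nlinarith)
    refine key (√(a ^ 2 + 4 * c ^ 2)) (by rw [hs]; ring) ?_ ?_
    · rw [add_zero, sub_zero, clampCoord_comm, clampCoord_of_abs_le habs]
    · rw [wingCoord, if_pos (by rw [mul_zero, sub_zero]; positivity), hs]
      rw [show a ^ 2 + 4 * c ^ 2 - (a + 0) ^ 2 = (2 * c) ^ 2 by ring,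
        Real.sqrt_sq (by positivity)]
      ring
  · have hs : √(b ^ 2 + 4 * c ^ 2) ^ 2 = b ^ 2 + 4 * c ^ 2 := Real.sq_sqrt (by positivity)
    have habs : |b| ≤ √(b ^ 2 + 4 * c ^ 2) := Real.abs_le_sqrt (by nlinarith)
    have hspos : 0 < √(b ^ 2 + 4 * c ^ 2) := Real.sqrt_pos.2 (by nlinarith)
    refine key (-√(b ^ 2 + 4 * c ^ 2)) (by rw [neg_sq, hs]; ring) ?_ ?_
    · rw [zero_add, zero_sub, clampCoord_neg_right, clampCoord_comm, clampCoord_of_abs_le habs]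
    · rw [wingCoord, if_neg (by nlinarith [sq_nonneg c]), neg_sq, hs]
      rw [show b ^ 2 + 4 * c ^ 2 - (0 + b) ^ 2 = (-(2 * c)) ^ 2 by ring,
        Real.sqrt_sq (by linarith)]
      ring

/-! ### The Einstein universe is Hausdorff -/

theorem nullVec_norm_pos (v : NullVec) : 0 < ‖v.1‖ := norm_pos_iff.2 v.2.1

/-- The representative of norm one separates the rays. -/
instance : T2Space DoubleEin := by
  have hwd : ∀ v w : NullVec, raySetoid v w → ‖v.1‖⁻¹ • v.1 = ‖w.1‖⁻¹ • w.1 := by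
    rintro v w ⟨c, hc, h⟩
    rw [h, norm_smul, Real.norm_of_nonneg hc.le, smul_smul, mul_inv]
    congr 1
    field_simp
  have hc : Continuous fun v : NullVec => ‖v.1‖⁻¹ • v.1 := by
    refine Continuous.smul (Continuous.inv₀ (by fun_prop) fun v => (nullVec_norm_pos v).ne') ?_
    exact continuous_subtype_val
  refine T2Space.of_injective_continuous (f := Quotient.lift _ hwd) ?_ (hc.quotient_lift hwd)
  rintro ⟨v⟩ ⟨w⟩ h
  have h : ‖v.1‖⁻¹ • v.1 = ‖w.1‖⁻¹ • w.1 := h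
  refine Quotient.sound ⟨‖w.1‖ * ‖v.1‖⁻¹,
    mul_pos (nullVec_norm_pos w) (inv_pos.2 (nullVec_norm_pos v)), ?_⟩
  rw [mul_smul, h, smul_inv_smul₀ (nullVec_norm_pos w).ne']

/-- The normalized symmetric tensor square separates the lines. -/
instance : T2Space Ein := by
  have hwd : ∀ v w : NullVec, projSetoid v w →
      (fun i j => (‖v.1‖ ^ 2)⁻¹ * (v.1 i * v.1 j) : Fin 5 → Fin 5 → ℝ) =
        fun i j => (‖w.1‖ ^ 2)⁻¹ * (w.1 i * w.1 j) := by
    rintro v w ⟨c, hc, h⟩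
    ext i j
    have hv := (nullVec_norm_pos v).ne'
    rw [h, norm_smul, mul_pow, Real.norm_eq_abs, sq_abs, Pi.smul_apply, Pi.smul_apply, smul_eq_mul,
      smul_eq_mul]
    field_simp
  have hc : Continuous fun v : NullVec =>
      (fun i j => (‖v.1‖ ^ 2)⁻¹ * (v.1 i * v.1 j) : Fin 5 → Fin 5 → ℝ) := by
    refine continuous_pi fun i => continuous_pi fun j => ?_
    refine Continuous.mul (Continuous.inv₀ (by fun_prop) fun v => ?_)
      (((continuous_apply i).comp continuous_subtype_val).mul
        ((continuous_apply j).comp continuous_subtype_val))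
    have := nullVec_norm_pos v
    positivity
  refine T2Space.of_injective_continuous (f := Quotient.lift _ hwd) ?_ (hc.quotient_lift hwd)
  rintro ⟨v⟩ ⟨w⟩ h
  have h : ∀ i j, (‖v.1‖ ^ 2)⁻¹ * (v.1 i * v.1 j) = (‖w.1‖ ^ 2)⁻¹ * (w.1 i * w.1 j) :=
    fun i j => congrFun (congrFun h i) j
  have hv := (nullVec_norm_pos v).ne'
  have hw := (nullVec_norm_pos w).ne'
  obtain ⟨i, hi⟩ : ∃ i, w.1 i ≠ 0 := Function.ne_iff.1 w.2.1
  have hvi : v.1 i ≠ 0 := by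
    intro h0
    have := h i i
    rw [h0] at this
    simp [hw, hi] at this
  refine Quotient.sound ⟨‖w.1‖ ^ 2 * v.1 i / (‖v.1‖ ^ 2 * w.1 i), by positivity, ?_⟩
  ext j
  have := h i j
  rw [Pi.smul_apply, smul_eq_mul]
  field_simp at this ⊢
  linear_combination -this

theorem continuous_einProj : Continuous einProj :=
  Continuous.quotient_map' continuous_id _

/-! ### The crooked surface -/

/-- The linear isomorphism of `ℝ⁵` that identifies the coordinates `(a, b, c, U, V)`, with null
form `c² - a b - U V`, with the coordinates of `ℝ³·²`: the point `p` and the null frame become the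
origin and the standard null frame. -/
def toNull (p v₁ v₂ v₃ : Mink) (y : Fin 5 → ℝ) : Fin 5 → ℝ :=
  ![y 4 * p 0 + comb v₁ v₂ v₃ (y 0) (y 1) (y 2) 0,
    y 4 * p 1 + comb v₁ v₂ v₃ (y 0) (y 1) (y 2) 1,
    y 4 * p 2 + comb v₁ v₂ v₃ (y 0) (y 1) (y 2) 2,
    y 4 * lorentz p p + 2 * lorentz p (comb v₁ v₂ v₃ (y 0) (y 1) (y 2)) + y 3, y 4]

theorem toNull_smul (p v₁ v₂ v₃ : Mink) (r : ℝ) (y : Fin 5 → ℝ) :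
    toNull p v₁ v₂ v₃ (r • y) = r • toNull p v₁ v₂ v₃ y := by
  ext i
  fin_cases i <;> simp [toNull, comb_smul, lorentz] <;> ring

theorem continuous_toNull (p v₁ v₂ v₃ : Mink) : Continuous (toNull p v₁ v₂ v₃) := by
  refine continuous_pi fun i => ?_
  fin_cases i <;> simp [toNull, comb, lorentz] <;> fun_prop

namespace NullFrame

variable {v₁ v₂ v₃ : Mink} (h : NullFrame v₁ v₂ v₃) (p : Mink)
include h

theorem toNull_injective : Function.Injective (toNull p v₁ v₂ v₃) := by
  intro y y' he
  have e0 := congrFun he 0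
  have e1 := congrFun he 1
  have e2 := congrFun he 2
  have e3 := congrFun he 3
  have e4 := congrFun he 4
  simp only [toNull, Matrix.cons_val] at e0 e1 e2 e3 e4
  rw [e4] at e0 e1 e2 e3
  have hw : comb v₁ v₂ v₃ (y 0) (y 1) (y 2) = comb v₁ v₂ v₃ (y' 0) (y' 1) (y' 2) := by
    ext i
    fin_cases i
    · exact add_left_cancel e0
    · exact add_left_cancel e1
    · exact add_left_cancel e2
  rw [hw] at e3
  obtain ⟨h0, h1, h2⟩ := h.comb_inj hw
  ext i
  fin_cases i
  · exact h0
  · exact h1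
  · exact h2
  · exact add_left_cancel e3
  · exact e4

theorem form32_toNull (y : Fin 5 → ℝ) :
    form32 (toNull p v₁ v₂ v₃ y) = y 2 ^ 2 - y 0 * y 1 - y 3 * y 4 := by
  have := h.lorentz_comb (y 0) (y 1) (y 2) (y 0) (y 1) (y 2)
  generalize hw : comb v₁ v₂ v₃ (y 0) (y 1) (y 2) = w at *
  simp only [form32, toNull, Matrix.cons_val, hw]
  simp only [lorentz] at *
  linear_combination this

theorem toNull_affine (a b c : ℝ) :
    toNull p v₁ v₂ v₃ ![a, b, c, c ^ 2 - a * b, 1] =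
      (paraboloid (p + comb v₁ v₂ v₃ a b c)).1 := by
  have := h.lorentz_comb a b c a b c
  ext i
  fin_cases i
  · simp [toNull, paraboloid]
  · simp [toNull, paraboloid]
  · simp [toNull, paraboloid]
  · simp only [toNull, paraboloid, Matrix.cons_val]
    generalize comb v₁ v₂ v₃ a b c = w at *
    simp [lorentz] at *
    linear_combination -this
  · simp [toNull, paraboloid]

end NullFrame

/-- The parametrization of the lifted surface in normalized coordinates: `z` is `(A, P)` and `w` is
`(k, Q)`. -/
noncomputable def circleCoord (x : Circle × Circle) : Fin 5 → ℝ :=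
  surfaceCoord (x.1 : ℂ).re (x.1 : ℂ).im (x.2 : ℂ).re (x.2 : ℂ).im

theorem circle_re_sq_add_im_sq (z : Circle) : (z : ℂ).re ^ 2 + (z : ℂ).im ^ 2 = 1 := by
  have := z.normSq_coe
  rw [Complex.normSq_apply] at this
  linarith

theorem circle_sq_eq (x : Circle × Circle) :
    (x.1 : ℂ).re ^ 2 + (x.1 : ℂ).im ^ 2 = (x.2 : ℂ).re ^ 2 + (x.2 : ℂ).im ^ 2 := by
  rw [circle_re_sq_add_im_sq, circle_re_sq_add_im_sq]

theorem continuous_circleCoord : Continuous circleCoord := by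
  have hw : Continuous fun x : Circle × Circle =>
      wingCoord (x.1 : ℂ).re (x.1 : ℂ).im (x.2 : ℂ).re :=
    continuousOn_wingCoord.comp_continuous
      (f := fun x : Circle × Circle =>
        ((x.1 : ℂ).re, (x.1 : ℂ).im, (x.2 : ℂ).re, (x.2 : ℂ).im)) (by fun_prop) circle_sq_eq
  refine continuous_pi fun i => ?_
  fin_cases i <;> simp [circleCoord, surfaceCoord, clampCoord]
  · fun_prop
  · fun_prop
  · exact hw
  · fun_prop
  · fun_prop

theorem circleCoord_ne_zero (x : Circle × Circle) : circleCoord x ≠ 0 := by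
  intro h0
  have e0 := congrFun h0 0
  have e1 := congrFun h0 1
  have e3 := congrFun h0 3
  have e4 := congrFun h0 4
  simp only [circleCoord, surfaceCoord, Matrix.cons_val, Pi.zero_apply] at e0 e1 e3 e4
  have h1 := circle_re_sq_add_im_sq x.1
  rw [show (x.1 : ℂ).re = 0 by linarith, show (x.1 : ℂ).im = 0 by linarith] at h1
  norm_num at h1

theorem circle_ext {z w : Circle} (hre : (z : ℂ).re = (w : ℂ).re)
    (him : (z : ℂ).im = (w : ℂ).im) : z = w :=
  Circle.ext (Complex.ext hre him)

/-- Distinct points of the torus have non-proportional coordinates, for positive factors: the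
parameters `(A, P)` are normalized. -/
theorem eq_of_circleCoord_eq_smul {x x' : Circle × Circle} {r : ℝ} (hr : 0 < r)
    (h : circleCoord x' = r • circleCoord x) : x = x' := by
  have h1 := circle_re_sq_add_im_sq x.1
  have h1' := circle_re_sq_add_im_sq x'.1
  obtain rfl : r = 1 := by
    have e0 := congrFun h 0
    have e1 := congrFun h 1
    have e3 := congrFun h 3
    have e4 := congrFun h 4
    simp only [circleCoord, surfaceCoord, Matrix.cons_val, Pi.smul_apply, smul_eq_mul]
      at e0 e1 e3 e4
    rw [show (x'.1 : ℂ).re = r * (x.1 : ℂ).re by linarith,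
      show (x'.1 : ℂ).im = r * (x.1 : ℂ).im by linarith] at h1'
    have : r ^ 2 = 1 := by linear_combination h1' - r ^ 2 * h1
    nlinarith
  rw [one_smul] at h
  obtain ⟨e1, e2, e3, e4⟩ := surfaceCoord_inj h1' (circle_re_sq_add_im_sq x'.2)
    (circle_re_sq_add_im_sq x.2) h
  exact Prod.ext (circle_ext e1.symm e2.symm) (circle_ext e3.symm e4.symm)

/-- The involution of the torus that corresponds to the antipodal map. -/
noncomputable def circleInvol (x : Circle × Circle) : Circle × Circle :=
  (Circle.exp Real.pi * x.1, x.2⁻¹)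

theorem circleCoord_circleInvol (x : Circle × Circle) :
    circleCoord (circleInvol x) = -circleCoord x := by
  rw [circleCoord, circleCoord, ← surfaceCoord_neg (circle_sq_eq x)]
  have h1 : ((circleInvol x).1 : ℂ) = -x.1 := by
    simp [circleInvol, Circle.coe_exp]
  have h2 : ((circleInvol x).2 : ℂ) = (starRingEnd ℂ) x.2 := by
    exact Circle.coe_inv_eq_conj _
  rw [h1, h2]
  simp

theorem exists_circle_of_sq {x y r : ℝ} (hr : 0 < r) (h : x ^ 2 + y ^ 2 = r ^ 2) :
    ∃ z : Circle, x = r * (z : ℂ).re ∧ y = r * (z : ℂ).im := by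
  refine ⟨⟨⟨x / r, y / r⟩, ?_⟩, ?_, ?_⟩
  · refine mem_sphere_zero_iff_norm.2 ?_
    rw [← sq_eq_sq₀ (norm_nonneg _) zero_le_one, Complex.sq_norm,
      Complex.normSq_apply]
    field_simp
    linarith
  · change x = r * (x / r)
    field_simp
  · change y = r * (y / r)
    field_simp

theorem exists_circleCoord_eq {a b c : ℝ} (h : CrookedCond a b c) :
    ∃ (x : Circle × Circle) (r : ℝ), 0 < r ∧ ![a, b, c, c ^ 2 - a * b, 1] = r • circleCoord x := by
  obtain ⟨A, P, k, Q, h1, h2, h3⟩ := exists_surfaceCoord_eq h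
  have hr : 0 < √(A ^ 2 + P ^ 2) := Real.sqrt_pos.2 h2
  have hsq : √(A ^ 2 + P ^ 2) ^ 2 = A ^ 2 + P ^ 2 := Real.sq_sqrt h2.le
  generalize √(A ^ 2 + P ^ 2) = r at *
  obtain ⟨z, hA, hP⟩ := exists_circle_of_sq hr hsq.symm
  obtain ⟨w, hk, hQ⟩ := exists_circle_of_sq hr (h1.symm.trans hsq.symm)
  refine ⟨(z, w), r, hr, ?_⟩
  rw [← h3, hA, hP, hk, hQ, surfaceCoord_smul hr, circleCoord]

namespace NullFrame

variable {v₁ v₂ v₃ : Mink} (h : NullFrame v₁ v₂ v₃) (p : Mink)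

/-- The parametrization of the lift of the crooked surface by the torus. -/
noncomputable def param (x : Circle × Circle) : DoubleEin :=
  Quotient.mk raySetoid ⟨toNull p v₁ v₂ v₃ (circleCoord x), by
    intro h0
    refine circleCoord_ne_zero x (h.toNull_injective p ?_)
    rw [h0]
    simpa using (toNull_smul p v₁ v₂ v₃ 0 0).symm, by
    rw [h.form32_toNull, circleCoord]
    linarith [surfaceCoord_null (circle_sq_eq x)]⟩

theorem continuous_param : Continuous (h.param p) :=
  continuous_quotient_mk'.comp
    (((continuous_toNull p v₁ v₂ v₃).comp continuous_circleCoord).subtype_mk _)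

theorem param_injective : Function.Injective (h.param p) := by
  intro x x' hx
  obtain ⟨r, hr, he⟩ := Quotient.exact hx
  refine eq_of_circleCoord_eq_smul hr (h.toNull_injective p ?_)
  rw [toNull_smul]
  exact he

/-- The two points of the double covering over a point of the surface are exchanged by the
antipodal map, which is `circleInvol` in the parameters. -/
theorem einProj_eq_param_iff (e : DoubleEin) (x : Circle × Circle) :
    einProj (h.param p x) = einProj e ↔ e = h.param p x ∨ e = h.param p (circleInvol x) := by
  obtain ⟨v, rfl⟩ := Quotient.exists_rep e
  constructor
  · intro he
    obtain ⟨r, hr, he⟩ := Quotient.exact he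
    rcases lt_or_gt_of_ne hr with hr | hr
    · right
      refine (Quotient.sound ⟨-r, by linarith, ?_⟩ : h.param p (circleInvol x) = _).symm
      have h1 : toNull p v₁ v₂ v₃ (circleCoord (circleInvol x)) =
          -toNull p v₁ v₂ v₃ (circleCoord x) := by
        rw [circleCoord_circleInvol, ← neg_one_smul ℝ, toNull_smul, neg_one_smul]
      change v.1 = -r • toNull p v₁ v₂ v₃ (circleCoord (circleInvol x))
      rw [h1, smul_neg, neg_smul, neg_neg]
      exact he
    · left
      exact (Quotient.sound ⟨r, hr, he⟩ : h.param p x = _).symm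
  · rintro (he | he)
    · rw [he]
    · rw [he]
      refine Quotient.sound ⟨-1, by norm_num, ?_⟩
      change toNull p v₁ v₂ v₃ (circleCoord (circleInvol x)) =
        (-1 : ℝ) • toNull p v₁ v₂ v₃ (circleCoord x)
      rw [circleCoord_circleInvol, ← toNull_smul, neg_one_smul]

theorem einProj_param_eq_embed {x : Circle × Circle} {a b c r : ℝ} (hr : r ≠ 0)
    (he : ![a, b, c, c ^ 2 - a * b, 1] = r • circleCoord x) :
    einProj (h.param p x) = embed (p + comb v₁ v₂ v₃ a b c) := by
  refine Quotient.sound ⟨r, hr, ?_⟩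
  change (paraboloid _).1 = r • toNull p v₁ v₂ v₃ (circleCoord x)
  rw [← toNull_smul, ← he, h.toNull_affine]

variable {C : Set Mink} {p}

theorem embed_subset_range (hC : ∀ a b c, p + comb v₁ v₂ v₃ a b c ∈ C ↔ CrookedCond a b c) :
    embed '' C ⊆ range fun x => einProj (h.param p x) := by
  rintro _ ⟨q, hq, rfl⟩
  obtain ⟨a, b, c, habc⟩ := h.exists_comb (q - p)
  obtain rfl : q = p + comb v₁ v₂ v₃ a b c := by rw [← habc]; simp
  obtain ⟨x, r, hr, he⟩ := exists_circleCoord_eq ((hC a b c).1 hq)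
  exact ⟨x, h.einProj_param_eq_embed p hr.ne' he⟩

/-- Points of the parametrized surface with `V ≠ 0` lie in Minkowski space, after division by `V`. -/
theorem einProj_param_mem_embed
    (hC : ∀ a b c, p + comb v₁ v₂ v₃ a b c ∈ C ↔ CrookedCond a b c) {x : Circle × Circle}
    (hx : circleCoord x 4 ≠ 0) : einProj (h.param p x) ∈ embed '' C := by
  set y := circleCoord x with hy
  refine ⟨p + comb v₁ v₂ v₃ (y 0 / y 4) (y 1 / y 4) (y 2 / y 4),
    (hC _ _ _).2 (crookedCond_surfaceCoord (circle_sq_eq x) hx), ?_⟩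
  refine (h.einProj_param_eq_embed p (inv_ne_zero hx) ?_).symm
  have hnull : y 2 ^ 2 = y 0 * y 1 + y 3 * y 4 := surfaceCoord_null (circle_sq_eq x)
  rw [← hy]
  ext i
  fin_cases i
  · simp; ring
  · simp; ring
  · simp; ring
  · simp
    field_simp
    linear_combination hnull
  · simp [hx]

end NullFrame

/-- The sine takes each value on a countable set. -/
theorem dense_sin_add_ne (s : ℝ) : Dense {t : ℝ | Real.sin t + s ≠ 0} := by
  have : {t : ℝ | Real.sin t + s ≠ 0} = {t : ℝ | Real.sin t = -s}ᶜ := by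
    ext t
    simp [add_eq_zero_iff_eq_neg]
  rw [this]
  refine Set.Countable.dense_compl ℝ ?_
  rcases {t : ℝ | Real.sin t = -s}.eq_empty_or_nonempty with h0 | ⟨t₀, ht₀⟩
  · rw [h0]; exact countable_empty
  have ht₀ : Real.sin t₀ = -s := ht₀
  refine ((countable_range fun k : ℤ => 2 * k * Real.pi + t₀).union
    (countable_range fun k : ℤ => (2 * k + 1) * Real.pi - t₀)).mono fun t ht => ?_
  have ht : Real.sin t = -s := ht
  rw [← ht₀, eq_comm, Real.sin_eq_sin_iff] at ht
  obtain ⟨k, hk | hk⟩ := ht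
  · exact .inl ⟨k, hk.symm⟩
  · exact .inr ⟨k, hk.symm⟩

namespace NullFrame

variable {v₁ v₂ v₃ : Mink} (h : NullFrame v₁ v₂ v₃) {p : Mink} {C : Set Mink}
include h

/-- The crooked surface is the image of the torus: this image is compact, and its points at
infinity are limits of points of the crooked plane, as they form a nowhere dense set `V = 0`. -/
theorem crookedSurface_eq_range
    (hC : ∀ a b c, p + comb v₁ v₂ v₃ a b c ∈ C ↔ CrookedCond a b c) :
    crookedSurface C = range fun x => einProj (h.param p x) := by
  have hcont : Continuous fun x => einProj (h.param p x) :=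
    continuous_einProj.comp (h.continuous_param p)
  refine Subset.antisymm (closure_minimal (h.embed_subset_range hC)
    (isCompact_range hcont).isClosed) ?_
  rintro _ ⟨⟨z, w⟩, rfl⟩
  obtain ⟨t, rfl⟩ : ∃ t, Circle.exp t = z := ⟨_, Circle.exp_arg z⟩
  -- Here `2 V = P + Q` is nonzero for a dense set of arguments of the first parameter.
  set g : ℝ → Ein := fun t => einProj (h.param p (Circle.exp t, w))
  have hg : Continuous g := hcont.comp (by fun_prop)
  have hsub : g '' {t : ℝ | Real.sin t + (w : ℂ).im ≠ 0} ⊆ embed '' C := by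
    rintro _ ⟨t, ht, rfl⟩
    refine h.einProj_param_mem_embed hC ?_
    simp only [circleCoord, surfaceCoord, Matrix.cons_val, Circle.coe_exp,
      Complex.exp_ofReal_mul_I_im]
    exact div_ne_zero ht two_ne_zero
  refine closure_mono hsub (image_closure_subset_closure_image hg ⟨t, ?_, rfl⟩)
  rw [(dense_sin_add_ne _).closure_eq]
  trivial

/-- The image of the torus is invariant under the antipodal map, hence it is a full preimage. -/
theorem lift_crookedSurface_eq_range
    (hC : ∀ a b c, p + comb v₁ v₂ v₃ a b c ∈ C ↔ CrookedCond a b c) :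
    lift (crookedSurface C) = range (h.param p) := by
  rw [h.crookedSurface_eq_range hC]
  ext e
  constructor
  · rintro ⟨x, hx⟩
    rcases (h.einProj_eq_param_iff p e x).1 hx with rfl | rfl
    · exact ⟨_, rfl⟩
    · exact ⟨_, rfl⟩
  · rintro ⟨x, rfl⟩
    exact ⟨x, rfl⟩

theorem nonempty_homeomorph_torus
    (hC : ∀ a b c, p + comb v₁ v₂ v₃ a b c ∈ C ↔ CrookedCond a b c) :
    Nonempty (lift (crookedSurface C) ≃ₜ Circle × Circle) := by
  rw [h.lift_crookedSurface_eq_range hC]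
  exact ⟨(((h.continuous_param p).isClosedEmbedding
    (h.param_injective p)).isEmbedding.toHomeomorph).symm⟩

/-- With `A + iP = exp (iπx)` and `k + iQ = exp (2πiy)`, the plane of the `x + iy` parametrizes the
lift of the crooked surface as a torus, and the antipodal map as a glide reflection. -/
theorem isGlideModel (hC : ∀ a b c, p + comb v₁ v₂ v₃ a b c ∈ C ↔ CrookedCond a b c) :
    ∃ f : ℂ → lift (crookedSurface C), IsGlideModel f (liftProj (crookedSurface C)) := by
  have hlift := h.lift_crookedSurface_eq_range hC
  set u : ℂ → Circle × Circle := fun z =>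
    (Circle.exp (Real.pi * z.re), Circle.exp (2 * Real.pi * z.im)) with hu
  have hucont : Continuous u := by fun_prop
  have hu_eq : ∀ z z', u z = u z' ↔ ∃ m n : ℤ, z' = z + 2 * m + n * Complex.I := by
    intro z z'
    have hpi := Real.pi_ne_zero
    rw [eq_comm]
    simp only [hu, Prod.mk.injEq, Circle.exp_eq_exp]
    constructor
    · rintro ⟨⟨m, hm⟩, ⟨n, hn⟩⟩
      refine ⟨m, n, Complex.ext ?_ ?_⟩
      · simp
        apply mul_left_cancel₀ hpi
        linear_combination hm
      · simp
        apply mul_left_cancel₀ hpi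
        linear_combination hn / 2
    · rintro ⟨m, n, rfl⟩
      exact ⟨⟨m, by simp; ring⟩, ⟨n, by simp; ring⟩⟩
  have hu_glide : ∀ z, u (glide z) = circleInvol (u z) := by
    intro z
    simp only [hu, circleInvol, glide, Prod.mk.injEq]
    constructor
    · rw [← Circle.exp_add]
      congr 1
      simp; ring
    · rw [← Circle.exp_neg]
      congr 1
      simp
  have hu_surj : Function.Surjective u := by
    rintro ⟨z, w⟩
    refine ⟨⟨Complex.arg z / Real.pi, Complex.arg w / (2 * Real.pi)⟩, ?_⟩
    simp only [hu]
    rw [mul_div_cancel₀ _ Real.pi_ne_zero, mul_div_cancel₀ _ Real.two_pi_pos.ne', Circle.exp_arg,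
      Circle.exp_arg]
  refine ⟨fun z => ⟨h.param p (u z), by rw [hlift]; exact ⟨_, rfl⟩⟩, ?_, ?_, ?_, ?_, ?_, ?_⟩
  · exact ((h.continuous_param p).comp hucont).subtype_mk _
  · exact (continuous_einProj.comp continuous_subtype_val).subtype_mk _
  · rintro ⟨e, he⟩
    rw [hlift] at he
    obtain ⟨x, rfl⟩ := he
    obtain ⟨z, rfl⟩ := hu_surj x
    exact ⟨z, rfl⟩
  · rintro ⟨s, hs⟩
    obtain ⟨x, rfl⟩ := h.crookedSurface_eq_range hC ▸ hs
    exact ⟨⟨h.param p x, hs⟩, rfl⟩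
  · intro z z'
    rw [Subtype.mk.injEq, (h.param_injective p).eq_iff, hu_eq]
  · intro z z'
    rw [Subtype.mk.injEq, Subtype.mk.injEq, Subtype.ext_iff]
    change einProj (h.param p (u z)) = einProj (h.param p (u z')) ↔ _
    rw [h.einProj_eq_param_iff, hu_glide, eq_comm, eq_comm (a := h.param p (circleInvol _))]

end NullFrame

end Crooked

theorem mainTheorem1 (C : Set Crooked.Mink) (hC : Crooked.IsCrookedPlane C) :
    Crooked.IsTopologicalSurface (Crooked.crookedSurface C) ∧
    Nonempty (Crooked.crookedSurface C ≃ₜ Crooked.KleinBottle) ∧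
    Crooked.IsOrientationDoubleCover (Crooked.liftProj (Crooked.crookedSurface C)) ∧
    Nonempty (Crooked.lift (Crooked.crookedSurface C) ≃ₜ Circle × Circle) := by
  obtain ⟨p, v₁, v₂, v₃, h, hC⟩ := hC.exists_nullFrame
  obtain ⟨f, hf⟩ := h.isGlideModel hC
  exact ⟨hf.isTopologicalSurface, hf.nonempty_homeomorph_kleinBottle, hf.isOrientationDoubleCover,
    h.nonempty_homeomorph_torus hC⟩
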